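/- Let $H$ be a Krull monoid, that is, a commutative cancellative monoid with a divisor theory $\varphi\colon H\to\mathcal F(P)$ into a free abelian monoid: $\varphi(a)\mid\varphi(b)$ implies $a\mid b$, and every $p\in P$ is the greatest common divisor of $\varphi(X)$ for some finite nonempty $X\subset H$. Let $G=\mathsf q(\mathcal F(P))/\mathsf q(\varphi(H))$ be its class group (where $\mathsf q$ denotes the quotient group), suppose that $G\cong C_2^r$ with $r\ge 1$, and suppose that every class $g\in G$ contains a prime divisor $p\in P$. For a commutative cancellative monoid $M$ let $\mathsf Z(M)$ be the free abelian monoid with basis the set of atoms of the reduced monoid $M_{\mathrm{red}}=M/M^\times$, let $\mathsf Z(a)\subset \mathsf Z(M)$ be the set of factorizations of $aM^\times$, and for $z,z'\in\mathsf Z(M)$ let $\mathsf d(z,z')=\max\{|z\gcd(z,z')^{-1}|,|z'\gcd(z,z')^{-1}|\}$, where $|\cdot|$ is the length. For $a\in M$ and an atom $u$ of $M_{\mathrm{red}}$ let $\mathsf t(a,u)\in\mathbb N_0\cup\{\infty\}$ be the smallest $N$ such that, if $\mathsf Z(a)\cap u\mathsf Z(M)\neq\emptyset$ and $z\in\mathsf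 Z(a)$, then there is $z'\in\mathsf Z(a)\cap u\mathsf Z(M)$ with $\mathsf d(z,z')\le N$. The tame degree of $M$ is $\mathsf t(M)=\sup_{a,u}\mathsf t(a,u)$. Put $\mathsf t(G)=\mathsf t(\mathcal B(G))$, where $\mathcal B(G)\subset\mathcal F(G)$ is the monoid of zero-sum sequences over $G$. Then: 1. If $r=1$, then $\mathsf t(H)=2$ and $\mathsf t(G)=0$. 2. If $r=3$, then $\mathsf t(G)=4$; and if moreover some nontrivial class contains at least two distinct prime divisors, then $\mathsf t(H)=5$. 3. If $r\ge 2$ is even, then $\mathsf t(H)=\mathsf t(G)=1+\frac{r^2}{2}$. If $r\ge 5$ is odd, then $\mathsf t(H)=\mathsf t(G)\ge 2+\frac{r(r-1)}{2}$. -/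

import Mathlib

noncomputable section

/-! ### Factorizations and the tame degree of a commutative monoid -/

/-- The factorization monoid `Z(H)`: the free commutative monoid on the set of atoms of the reduced
monoid `H_red = Associates H`, written additively (as multisets of atoms). -/
abbrev FactMonoid (H : Type*) [CommMonoid H] : Type _ :=
  Multiset {u : Associates H // Irreducible u}

/-- The factorization homomorphism `π : Z(H) → H_red`. -/
def factProd {H : Type*} [CommMonoid H] (z : FactMonoid H) : Associates H :=
  (z.map Subtype.val).prod

/-- The set `Z(a)` of factorizations of `a`. -/
def factSet {H : Type*} [CommMonoid H] (a : H) : Set (FactMonoid H) :=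
  {z | factProd z = Associates.mk a}

open Classical in
/-- The distance `d(z, z') = max (|z gcd(z,z')⁻¹|, |z' gcd(z,z')⁻¹|)` of two factorizations
(`z ∩ z'` is the greatest common divisor in the free monoid). -/
def factDist {H : Type*} [CommMonoid H] (z z' : FactMonoid H) : ℕ :=
  max (z - z ∩ z').card (z' - z ∩ z').card

/-- `t(a, x)`: the smallest `N ∈ ℕ₀ ∪ {∞}` such that, if `Z(a) ∩ x Z(H) ≠ ∅` and `z ∈ Z(a)`, then
there is `z' ∈ Z(a) ∩ x Z(H)` with `d(z, z') ≤ N`. (For multisets, `x ≤ z'` says `z' ∈ x Z(H)`.) -/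
def tameDegreeAt {H : Type*} [CommMonoid H] (a : H) (x : FactMonoid H) : ℕ∞ :=
  sInf {N : ℕ∞ | (∃ y ∈ factSet a, x ≤ y) →
    ∀ z ∈ factSet a, ∃ z' ∈ factSet a, x ≤ z' ∧ (factDist z z' : ℕ∞) ≤ N}

/-- The local tame degree `t(H, u) = sup {t(a, u) | a ∈ H}` for an atom `u` of `H_red`. -/
def localTameDegree (H : Type*) [CommMonoid H] (u : {u : Associates H // Irreducible u}) : ℕ∞ :=
  ⨆ a : H, tameDegreeAt a {u}

/-- The tame degree `t(H) = sup {t(H, u) | u an atom of H_red}`. -/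
def tameDegree (H : Type*) [CommMonoid H] : ℕ∞ :=
  ⨆ u : {u : Associates H // Irreducible u}, localTameDegree H u

/-! ### Divisor theories and class groups -/

/-- The free commutative monoid `F(P)` with basis `P`, written multiplicatively. -/
abbrev FreeCM (P : Type*) : Type _ := Multiplicative (Multiset P)

/-- The basis element of `F(P)` given by `p : P`. -/
def FreeCM.of {P : Type*} (p : P) : FreeCM P := Multiplicative.ofAdd {p}

/-- `φ : H → F(P)` is a divisor theory: it is a divisor homomorphism, and every `p ∈ P` is the
greatest common divisor of `φ(X)` for some finite nonempty `X ⊆ H`. -/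
structure IsDivisorTheory {H P : Type*} [CommMonoid H] (φ : H →* FreeCM P) : Prop where
  dvd_of_map_dvd : ∀ a b : H, φ a ∣ φ b → a ∣ b
  exists_gcd : ∀ p : P, ∃ X : Finset H, X.Nonempty ∧
    ∀ d : FreeCM P, d ∣ FreeCM.of p ↔ ∀ x ∈ X, d ∣ φ x

/-- The class group `q(F(P)) / q(φ(H))` of `φ`; here `q(φ(H))` is the subgroup of the quotient group
`q(F(P))` generated by `φ(H)`. -/
abbrev DivClassGroup {H P : Type*} [CommMonoid H] (φ : H →* FreeCM P) : Type _ :=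
  Algebra.GrothendieckGroup (FreeCM P) ⧸
    Subgroup.closure (Set.range fun a : H => Algebra.GrothendieckGroup.of (φ a))

/-- The class `[p]` of the prime divisor `p`. -/
def primeClass {H P : Type*} [CommMonoid H] (φ : H →* FreeCM P) (p : P) : DivClassGroup φ :=
  QuotientGroup.mk (Algebra.GrothendieckGroup.of (FreeCM.of p))

/-! ### Zero-sum sequences -/

/-- The monoid `B(G)` of zero-sum sequences over `G`, a submonoid of `F(G)`. -/
def zeroSumMonoid (G : Type*) [AddCommGroup G] : Submonoid (FreeCM G) where
  carrier := {S | (Multiplicative.toAdd S).sum = 0}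
  one_mem' := by simp
  mul_mem' := by
    intro S T hS hT
    change (Multiplicative.toAdd S).sum = 0 at hS
    change (Multiplicative.toAdd T).sum = 0 at hT
    change (Multiplicative.toAdd (S * T)).sum = 0
    rw [toAdd_mul, Multiset.sum_add, hS, hT, add_zero]

/-- `t(G) = t(B(G))`. -/
def zeroSumTameDegree (G : Type*) [AddCommGroup G] : ℕ∞ :=
  tameDegree (zeroSumMonoid G)

end

/-! Both `H` and the monoid of zero-sum sequences are modelled by sequences over a set `P` with a
class map `c` into `V = 𝔽₂^r`, whose atoms are the sequences with minimal zero-sum image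
(`IsClassModel`, `TameBound`). In `V`, zero-sum free sequences are linearly independent sets, so
atoms have length at most `r + 1`, and an atom with a repeated class is a square of that class.

Upper bounds. Given an atom `u` dividing a product of atoms, discard factors until none is
superfluous. What remains is `∏ (uᵢ + wᵢ)` with `u = ∑ uᵢ`, and one must factor `W = ∑ wᵢ` into few
atoms (`tameBound_of_reduced`). There are at most `|u| ≤ r + 1` rows `wᵢ`, each zero-sum free.
Halving `|W|` gives the desired bound unless the number of rows is close to `r + 1`. For an odd
number of rows, `exists_short_isFact_of_odd` gains enough over this trivial bound. It uses induction
on the rank: either no vector is frequent, and a shortest factorization contains few squares, or a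
frequent vector `e` is contracted, and sequences summing to `e` are completed by copies of `e`. This
settles even `r`. For odd `r` the only remaining case is `r + 1` rows. If some class of `u` occurs
in a foreign row, an exchange splits off an atom and leaves `r` rows; otherwise the configuration
projects to `V` without cancellation, and `t(G)` bounds it. Hence `t(H) ≤ max(t(G), 2 + r(r - 1)/2)`
(`tameBound_of_odd`). In rank three, linear forms exclude the long configurations over `V` itself,
giving `t(G) ≤ 4`.

Lower bounds. If `W` is supported on independent classes, all its factorizations consist of pairs,
so the length is forced. Choosing a minimal zero-sum sequence `U` of large total Hamming weight and
the product of the circuits `x + supp(x)`, `x ∈ U`, gives the bounds for even `r ≥ 4` and odd `r ≥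
5` (`TameBound.exists_hammingWt_le`). In rank three, two primes in one class allow a configuration
reaching 5 (`TameBound.five_le`). -/

noncomputable section

/-- `s` is zero-sum free: it has no nonempty zero-sum subsequence. -/
def ZeroSumFree {V : Type*} [AddCommMonoid V] (s : Multiset V) : Prop :=
  ∀ t ≤ s, t.sum = 0 → t = 0

/-- `s` is a minimal zero-sum sequence, that is, an atom of the monoid of zero-sum sequences. -/
structure IsMinZeroSum {V : Type*} [AddCommMonoid V] (s : Multiset V) : Prop where
  ne_zero : s ≠ 0
  sum_eq : s.sum = 0
  eq_of_le : ∀ t ≤ s, t.sum = 0 → t ≠ 0 → t = s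

/-- `z` is a factorization of `W` into sequences over `P` whose images under `c` are minimal
zero-sum sequences. -/
structure IsFact {P V : Type*} [AddCommMonoid V] (c : P → V) (W : Multiset P)
    (z : Multiset (Multiset P)) : Prop where
  sum_eq : z.sum = W
  atom : ∀ a ∈ z, IsMinZeroSum (a.map c)

/-! ### Sums and lifts of multisets of multisets. -/

section Multisets

variable {α β : Type*}

theorem Multiset.le_sum_of_mem_multiset {z : Multiset (Multiset α)} {a : Multiset α} (h : a ∈ z) :
    a ≤ z.sum := by
  obtain ⟨t, rfl⟩ := Multiset.exists_cons_of_mem h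
  rw [Multiset.sum_cons]
  exact Multiset.le_add_right _ _

theorem Multiset.mem_sum_multiset {z : Multiset (Multiset α)} {x : α} :
    x ∈ z.sum ↔ ∃ a ∈ z, x ∈ a := Multiset.mem_join

theorem Multiset.sum_le_sum_of_le {z z' : Multiset (Multiset α)} (h : z ≤ z') : z.sum ≤ z'.sum := by
  obtain ⟨t, rfl⟩ := Multiset.le_iff_exists_add.1 h
  rw [Multiset.sum_add]
  exact Multiset.le_add_right _ _

theorem Multiset.mul_card_le_card_sum {k : ℕ} {z : Multiset (Multiset α)}
    (h : ∀ a ∈ z, k ≤ a.card) : k * z.card ≤ z.sum.card := by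
  induction z using Multiset.induction_on with
  | empty => simp
  | cons a s ih =>
    have h1 := h a (by simp)
    have h2 := ih fun b hb => h b (by simp [hb])
    simp only [Multiset.card_cons, Multiset.sum_cons, Multiset.card_add, mul_add]
    omega

theorem Multiset.card_sum_le_mul_card {k : ℕ} {z : Multiset (Multiset α)}
    (h : ∀ a ∈ z, a.card ≤ k) : z.sum.card ≤ k * z.card := by
  induction z using Multiset.induction_on with
  | empty => simp
  | cons a s ih =>
    have h1 := h a (by simp)
    have h2 := ih fun b hb => h b (by simp [hb])
    simp only [Multiset.card_cons, Multiset.sum_cons, Multiset.card_add, mul_add]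
    omega

theorem Multiset.map_sum_multiset (f : α → β) (z : Multiset (Multiset α)) :
    z.sum.map f = (z.map (Multiset.map f)).sum := Multiset.map_join f z

theorem Multiset.exists_le_card_eq {s : Multiset α} {n : ℕ} (h : n ≤ s.card) :
    ∃ t ≤ s, t.card = n := by
  refine ⟨(s.toList.take n : List α), ?_, ?_⟩
  · conv_rhs => rw [← s.coe_toList]
    exact Multiset.coe_le.2 (List.take_sublist _ _).subperm
  · simpa using h

theorem Multiset.exists_map_eq_add {f : α → β} {W : Multiset α} {s t : Multiset β}
    (h : W.map f = s + t) : ∃ S T, W = S + T ∧ S.map f = s ∧ T.map f = t := by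
  induction W using Multiset.induction_on generalizing s t with
  | empty =>
    have h0 : s + t = 0 := by simpa using h.symm
    obtain ⟨rfl, rfl⟩ : s = 0 ∧ t = 0 := by simpa using h0
    exact ⟨0, 0, by simp⟩
  | cons a W ih =>
    rw [Multiset.map_cons] at h
    have hm : f a ∈ s + t := h ▸ Multiset.mem_cons_self _ _
    rcases Multiset.mem_add.1 hm with hm | hm
    · obtain ⟨s', rfl⟩ := Multiset.exists_cons_of_mem hm
      rw [Multiset.cons_add] at h
      obtain ⟨S, T, rfl, rfl, rfl⟩ := ih ((Multiset.cons_inj_right _).1 h)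
      exact ⟨a ::ₘ S, T, by simp, by simp, rfl⟩
    · obtain ⟨s', rfl⟩ := Multiset.exists_cons_of_mem hm
      rw [Multiset.add_cons] at h
      obtain ⟨S, T, rfl, rfl, rfl⟩ := ih ((Multiset.cons_inj_right _).1 h)
      exact ⟨S, a ::ₘ T, by simp, rfl, by simp⟩

/-- This is what transports factorizations from classes back to primes, and from a quotient of `V`
back to `V`. The lift need not be unique. -/
theorem Multiset.exists_lift_sum {f : α → β} {W : Multiset α} {z : Multiset (Multiset β)}
    (h : W.map f = z.sum) :
    ∃ y : Multiset (Multiset α), y.sum = W ∧ y.map (Multiset.map f) = z := by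
  induction z using Multiset.induction_on generalizing W with
  | empty =>
    have : W = 0 := by simpa using h
    exact ⟨0, by simp [this]⟩
  | cons a z ih =>
    rw [Multiset.sum_cons] at h
    obtain ⟨S, T, rfl, rfl, hT⟩ := Multiset.exists_map_eq_add h
    obtain ⟨y, rfl, rfl⟩ := ih hT
    exact ⟨S ::ₘ y, by simp, by simp⟩

theorem Multiset.exists_map_eq_of_le {f : α → β} {W : Multiset α} {s : Multiset β}
    (h : s ≤ W.map f) : ∃ S ≤ W, S.map f = s := by
  obtain ⟨t, ht⟩ := Multiset.le_iff_exists_add.1 h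
  obtain ⟨S, T, rfl, rfl, _⟩ := Multiset.exists_map_eq_add ht
  exact ⟨S, Multiset.le_add_right _ _, rfl⟩

end Multisets

/-! ### Zero-sum free sequences, minimal zero-sum sequences and factorizations. -/

section Basic

variable {V : Type*} [AddCommGroup V]

theorem ZeroSumFree.mono {s t : Multiset V} (h : ZeroSumFree s) (hts : t ≤ s) : ZeroSumFree t :=
  fun u hu h0 => h u (hu.trans hts) h0

theorem ZeroSumFree.zero_notMem {s : Multiset V} (h : ZeroSumFree s) : (0 : V) ∉ s := by
  intro h0
  have := h {0} (Multiset.singleton_le.2 h0) (by simp)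
  simp at this

theorem IsMinZeroSum.zeroSumFree {s t : Multiset V} (h : IsMinZeroSum s) (hts : t < s) :
    ZeroSumFree t := by
  intro u hu h0
  by_contra hne
  have := h.eq_of_le u (hu.trans hts.le) h0 hne
  exact absurd (this ▸ hu) (not_le_of_gt hts)

theorem IsMinZeroSum.two_le_card {s : Multiset V} (h : IsMinZeroSum s) (h0 : (0 : V) ∉ s) :
    2 ≤ s.card := by
  by_contra hlt
  have : s.card = 0 ∨ s.card = 1 := by omega
  rcases this with h1 | h1
  · exact h.ne_zero (Multiset.card_eq_zero.1 h1)
  · obtain ⟨a, rfl⟩ := Multiset.card_eq_one.1 h1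
    have := h.sum_eq
    simp at this
    simp [this] at h0

theorem IsMinZeroSum.eq_singleton_zero {s : Multiset V} (h : IsMinZeroSum s) (h0 : (0 : V) ∈ s) :
    s = {0} :=
  (h.eq_of_le {0} (Multiset.singleton_le.2 h0) (by simp) (by simp)).symm

theorem ZeroSumFree.notMem_of_sum_eq {A : Multiset V} {e : V} (hA : ZeroSumFree A)
    (hs : A.sum = e) (h2 : 2 ≤ A.card) : e ∉ A := by
  intro he
  obtain ⟨t, rfl⟩ := Multiset.exists_cons_of_mem he
  rw [Multiset.sum_cons, add_eq_left] at hs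
  rw [hA t (Multiset.le_cons_self _ _) hs] at h2
  simp at h2

theorem exists_isFact {P : Type*} (c : P → V) (W : Multiset P) (hW : (W.map c).sum = 0) :
    ∃ z, IsFact c W z := by
  induction hn : W.card using Nat.strong_induction_on generalizing W with
  | _ n ih =>
  subst hn
  by_cases h0 : W = 0
  · exact ⟨0, by simp [h0], by simp⟩
  by_cases hmin : ∃ t ≤ W, (t.map c).sum = 0 ∧ t ≠ 0 ∧ t ≠ W
  · obtain ⟨t, htW, ht0, htne, htneW⟩ := hmin
    obtain ⟨t', rfl⟩ := Multiset.le_iff_exists_add.1 htW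
    have ht' : t' ≠ 0 := by rintro rfl; simp at htneW
    have hc := Multiset.card_pos.2 htne
    have hc' := Multiset.card_pos.2 ht'
    rw [Multiset.map_add, Multiset.sum_add, ht0, zero_add] at hW
    obtain ⟨z, hz⟩ := ih t.card (by simp; omega) t ht0 rfl
    obtain ⟨z', hz'⟩ := ih t'.card (by simp; omega) t' hW rfl
    refine ⟨z + z', by rw [Multiset.sum_add, hz.sum_eq, hz'.sum_eq], fun a ha => ?_⟩
    rcases Multiset.mem_add.1 ha with ha | ha
    · exact hz.atom a ha
    · exact hz'.atom a ha
  · push Not at hmin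
    refine ⟨{W}, by simp, fun a ha => ?_⟩
    rw [Multiset.mem_singleton.1 ha]
    refine ⟨by simpa using h0, hW, fun t ht h1 h2 => ?_⟩
    obtain ⟨S, hS, rfl⟩ := Multiset.exists_map_eq_of_le ht
    rw [hmin S hS h1 (by rintro rfl; simp at h2)]

theorem Multiset.sum_sum_eq_card_nsmul {y : Multiset (Multiset V)} {e : V}
    (h : ∀ a ∈ y, a.sum = e) : y.sum.sum = y.card • e := by
  induction y using Multiset.induction_on with
  | empty => simp
  | cons a y ih =>
    rw [Multiset.sum_cons, Multiset.sum_add, h a (by simp), ih fun b hb => h b (by simp [hb]),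
      Multiset.card_cons, add_smul, one_smul, add_comm]

theorem IsFact.sum_map_eq_zero {P : Type*} {c : P → V} {W : Multiset P}
    {z : Multiset (Multiset P)} (hz : IsFact c W z) : (W.map c).sum = 0 := by
  rw [← hz.sum_eq, Multiset.map_sum_multiset, Multiset.sum_sum_eq_card_nsmul (e := 0), smul_zero]
  intro a ha
  obtain ⟨b, hb, rfl⟩ := Multiset.mem_map.1 ha
  exact (hz.atom b hb).sum_eq

theorem IsFact.two_le_card {P : Type*} {c : P → V} {W : Multiset P} {z : Multiset (Multiset P)}
    (hz : IsFact c W z) (h0 : (0 : V) ∉ W.map c) {a : Multiset P} (ha : a ∈ z) : 2 ≤ a.card := by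
  have := (hz.atom a ha).two_le_card fun h => h0 ?_
  · simpa using this
  · exact Multiset.mem_of_le (Multiset.map_le_map (hz.sum_eq ▸ Multiset.le_sum_of_mem_multiset ha)) h

theorem IsFact.two_mul_card_le {P : Type*} {c : P → V} {W : Multiset P}
    {z : Multiset (Multiset P)} (hz : IsFact c W z) (h0 : (0 : V) ∉ W.map c) :
    2 * z.card ≤ W.card := by
  have := Multiset.mul_card_le_card_sum (z := z) (k := 2) fun a ha => hz.two_le_card h0 ha
  rwa [hz.sum_eq] at this

theorem IsFact.add {P : Type*} {c : P → V} {W W' : Multiset P}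
    {z z' : Multiset (Multiset P)} (hz : IsFact c W z) (hz' : IsFact c W' z') :
    IsFact c (W + W') (z + z') := by
  refine ⟨by rw [Multiset.sum_add, hz.sum_eq, hz'.sum_eq], fun a ha => ?_⟩
  rcases Multiset.mem_add.1 ha with ha | ha
  · exact hz.atom a ha
  · exact hz'.atom a ha

/-- Factorizations of the image of `W` lift to factorizations of `W`. -/
theorem IsFact.exists_lift {P : Type*} {c : P → V} {W : Multiset P}
    {z : Multiset (Multiset V)} (hz : IsFact id (W.map c) z) :
    ∃ y, IsFact c W y ∧ y.card = z.card := by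
  obtain ⟨y, hy, rfl⟩ := Multiset.exists_lift_sum hz.sum_eq.symm
  refine ⟨y, ⟨hy, fun a ha => ?_⟩, by simp⟩
  simpa using hz.atom (a.map c) (Multiset.mem_map_of_mem _ ha)

end Basic

/-! ### Elementary `2`-groups: independence and factorizations with few squares. -/

section CharTwo

variable {V : Type*} [AddCommGroup V] [Module (ZMod 2) V]

theorem isMinZeroSum_pair {x : V} (hx : x ≠ 0) : IsMinZeroSum ({x, x} : Multiset V) := by
  refine ⟨by simp, by simpa using ZModModule.add_self x, fun t ht h0 hne => ?_⟩
  by_contra hn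
  have hlt := Multiset.card_lt_card (lt_of_le_of_ne ht hn)
  have hpos := Multiset.card_pos.2 hne
  have h1 : t.card = 1 := by simp at hlt; omega
  obtain ⟨a, rfl⟩ := Multiset.card_eq_one.1 h1
  have := Multiset.mem_of_le ht (Multiset.mem_singleton_self a)
  simp at this h0
  exact hx (this ▸ h0)

theorem IsMinZeroSum.eq_pair {s : Multiset V} (h : IsMinZeroSum s) {x : V} (hx : {x, x} ≤ s) :
    s = {x, x} :=
  (h.eq_of_le _ hx (by simpa using ZModModule.add_self x) (by simp)).symm

theorem even_of_nsmul_eq_zero {e : V} (he : e ≠ 0) {k : ℕ} (hk : k • e = 0) : Even k := by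
  by_contra ho
  obtain ⟨m, rfl⟩ := Nat.not_even_iff_odd.1 ho
  rw [add_smul, mul_comm, mul_smul, two_nsmul, ZModModule.add_self, smul_zero, zero_add,
    one_smul] at hk
  exact he hk

theorem nsmul_eq_zero_or_self (e : V) (k : ℕ) : k • e = 0 ∨ k • e = e := by
  induction k with
  | zero => simp
  | succ k ih =>
    rw [succ_nsmul]
    rcases ih with h | h <;> simp [h, ZModModule.add_self]

theorem ZeroSumFree.nodup {s : Multiset V} (h : ZeroSumFree s) : s.Nodup := by
  rw [Multiset.nodup_iff_le]
  intro a ha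
  have := h _ ha (by simpa using ZModModule.add_self a)
  simp at this

/-- Over `𝔽₂` a linear relation is the vanishing of the sum over the support of its coefficients. -/
theorem ZeroSumFree.linearIndepOn {s : Finset V} (h : ZeroSumFree s.val) :
    LinearIndepOn (ZMod 2) id (s : Set V) := by
  classical
  rw [linearIndepOn_finset_iff]
  intro f hf i hi
  by_contra hne
  have h1 : ∀ a : ZMod 2, a ≠ 0 → a = 1 := by decide
  have h2 := h (s.filter fun i => f i ≠ 0).val
    (Finset.val_le_iff.2 (Finset.filter_subset _ _)) ?_
  · rw [Finset.val_eq_zero, Finset.filter_eq_empty_iff] at h2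
    exact h2 hi hne
  · have h3 : ∑ x ∈ s.filter (fun i => f i ≠ 0), x = 0 := by
      rw [← hf, Finset.sum_filter]
      refine Finset.sum_congr rfl fun x _ => ?_
      by_cases hx : f x = 0
      · simp [hx]
      · simp [h1 _ hx]
    simpa [Finset.sum] using h3

theorem ZeroSumFree.card_le [FiniteDimensional (ZMod 2) V] {s : Multiset V} (h : ZeroSumFree s) :
    s.card ≤ Module.finrank (ZMod 2) V := by
  have h' : ZeroSumFree (⟨s, h.nodup⟩ : Finset V).val := h
  exact LinearIndependent.finset_card_le_finrank (b := ⟨s, h.nodup⟩) h'.linearIndepOn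

theorem IsMinZeroSum.card_le [FiniteDimensional (ZMod 2) V] {s : Multiset V}
    (h : IsMinZeroSum s) : s.card ≤ Module.finrank (ZMod 2) V + 1 := by
  obtain ⟨a, ha⟩ := Multiset.exists_mem_of_ne_zero h.ne_zero
  obtain ⟨t, rfl⟩ := Multiset.exists_cons_of_mem ha
  have := (h.zeroSumFree (Multiset.lt_cons_self t a)).card_le
  simpa using this

theorem IsMinZeroSum.nodup {s : Multiset V} (h : IsMinZeroSum s) (hs : s.card ≠ 2) : s.Nodup := by
  rw [Multiset.nodup_iff_le]
  intro a ha
  exact hs (by rw [h.eq_pair ha]; simp)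

theorem IsMinZeroSum.exists_eq_pair {s : Multiset V} (h : IsMinZeroSum s) (hs : s.card = 2) :
    ∃ x, s = {x, x} := by
  obtain ⟨x, y, rfl⟩ := Multiset.card_eq_two.1 hs
  have := h.sum_eq
  simp only [Multiset.insert_eq_cons, Multiset.sum_cons, Multiset.sum_singleton] at this
  have hxy : y = x := by
    have h2 := ZModModule.add_self x
    exact add_left_cancel (this.trans h2.symm)
  exact ⟨x, by rw [hxy]⟩

/-- If every element occurs at most `b` times in `W`, then a shortest factorization of `W` is
short: the elements whose squares occur in it are independent. -/
theorem exists_isFact_of_count_le [DecidableEq V] [FiniteDimensional (ZMod 2) V] {W : Multiset V}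
    (hW : W.sum = 0) (h0 : (0 : V) ∉ W) {b : ℕ} (hb : ∀ x, W.count x ≤ b) :
    ∃ z, IsFact id W z ∧ 6 * z.card ≤ 2 * W.card + b * Module.finrank (ZMod 2) V := by
  classical
  have hex : ∃ n z, IsFact id W z ∧ z.card = n := by
    obtain ⟨z, hz⟩ := exists_isFact id W (by simpa using hW)
    exact ⟨_, z, hz, rfl⟩
  -- A factorization of least length; `D` will list the vectors whose squares occur in it.
  obtain ⟨z, hz, hzn⟩ := Nat.find_spec hex
  have hmin : ∀ z', IsFact id W z' → z.card ≤ z'.card := fun z' hz' => by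
    rw [hzn]; exact Nat.find_min' hex ⟨z', hz', rfl⟩
  refine ⟨z, hz, ?_⟩
  have h0' : (0 : V) ∉ W.map id := by simpa using h0
  obtain ⟨D, hD⟩ : ∃ D : Multiset V, z.filter (fun a => a.card = 2) = D.map fun d => {d, d} := by
    have : ∀ y : Multiset (Multiset V), (∀ a ∈ y, ∃ d, a = {d, d}) →
        ∃ D : Multiset V, y = D.map fun d => {d, d} := by
      intro y
      induction y using Multiset.induction_on with
      | empty => exact fun _ => ⟨0, rfl⟩
      | cons a y ih =>
        intro h
        obtain ⟨D, rfl⟩ := ih fun b hb => h b (by simp [hb])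
        obtain ⟨d, rfl⟩ := h a (by simp)
        exact ⟨d ::ₘ D, by simp⟩
    refine this _ fun a ha => ?_
    rw [Multiset.mem_filter] at ha
    exact IsMinZeroSum.exists_eq_pair (by simpa using hz.atom a ha.1) ha.2
  have hsplit := Multiset.filter_add_not (fun a : Multiset V => a.card = 2) z
  set z3 := z.filter (fun a => ¬ a.card = 2) with hz3
  rw [hD] at hsplit
  have hsum : ∀ E : Multiset V, (E.map fun d => ({d, d} : Multiset V)).sum = E + E := by
    intro E
    induction E using Multiset.induction_on with
    | empty => simp
    | cons a E ih =>
      rw [Multiset.map_cons, Multiset.sum_cons, ih]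
      simp only [Multiset.insert_eq_cons, ← Multiset.singleton_add]
      abel
  have hWs : W = D + D + z3.sum := by rw [← hz.sum_eq, ← hsplit, Multiset.sum_add, hsum]
  have h3 : 3 * z3.card ≤ z3.sum.card := by
    refine Multiset.mul_card_le_card_sum fun a ha => ?_
    rw [hz3, Multiset.mem_filter] at ha
    have := hz.two_le_card h0' ha.1
    omega
  -- Exchange argument: if distinct members of `D` form a zero-sum `t`, the `|t|` squares over `t`
  -- can be replaced by two copies of a factorization `y` of `t`. Its atoms have length at least 3,
  -- so `2|y| < |t|`, against minimality.
  have hfree : ZeroSumFree D.dedup := by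
    intro t ht ht0
    by_contra hne
    have htD : t ≤ D := ht.trans (Multiset.dedup_le D)
    have hnd : t.Nodup := Multiset.nodup_of_le ht (Multiset.nodup_dedup D)
    obtain ⟨D', rfl⟩ := Multiset.le_iff_exists_add.1 htD
    obtain ⟨y, hy⟩ := exists_isFact id t (by simpa using ht0)
    have hy3 : 3 * y.card ≤ t.card := by
      have := Multiset.mul_card_le_card_sum (z := y) (k := 3) fun a ha => ?_
      · rwa [hy.sum_eq] at this
      have hat : a ≤ t := hy.sum_eq ▸ Multiset.le_sum_of_mem_multiset ha
      have hmin : IsMinZeroSum a := by simpa using hy.atom a ha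
      have h2 := hmin.two_le_card fun h => h0 (by
        rw [hWs]
        exact Multiset.mem_add.2 (Or.inl (Multiset.mem_add.2 (Or.inl (Multiset.mem_add.2
          (Or.inl (Multiset.mem_of_le hat h)))))))
      rcases h2.lt_or_eq with h2 | h2
      · exact h2
      · obtain ⟨x, rfl⟩ := hmin.exists_eq_pair h2.symm
        exact absurd (Multiset.nodup_of_le hat hnd) (by simp)
    have hpos := Multiset.card_pos.2 hne
    have hlt := hmin (y + y + (D'.map (fun d => {d, d}) + z3)) ?_
    · rw [← hsplit] at hlt
      simp at hlt
      omega
    · refine ⟨?_, fun a ha => ?_⟩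
      · rw [hWs, Multiset.sum_add, Multiset.sum_add, Multiset.sum_add, hy.sum_eq, hsum]
        abel
      · simp only [Multiset.mem_add, or_self] at ha
        rcases ha with ha | ha | ha
        · exact hy.atom a ha
        all_goals
          refine hz.atom a ?_
          rw [← hsplit]
          simp only [Multiset.map_add, Multiset.mem_add]
          tauto
  have hcard : 2 * D.card ≤ b * Module.finrank (ZMod 2) V := by
    have h1 : D.card = ∑ d ∈ D.toFinset, D.count d := (Multiset.toFinset_sum_count_eq D).symm
    have h2 : ∑ d ∈ D.toFinset, 2 * D.count d ≤ ∑ d ∈ D.toFinset, b := by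
      refine Finset.sum_le_sum fun d _ => ?_
      have := hb d
      rw [hWs, Multiset.count_add, Multiset.count_add] at this
      omega
    rw [h1, Finset.mul_sum]
    refine h2.trans ?_
    rw [Finset.sum_const, smul_eq_mul, mul_comm]
    exact Nat.mul_le_mul_left _ hfree.card_le
  -- With `|W| ≥ 2|D| + 3|z3|`, this gives `6|z| ≤ 2|W| + 2|D|`, and `hcard` bounds `2|D|`.
  have hz_card : z.card = D.card + z3.card := by rw [← hsplit]; simp
  have hW_card : W.card = 2 * D.card + z3.sum.card := by
    conv_lhs => rw [hWs]
    simp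
    omega
  omega

end CharTwo

/-! ### Short factorizations of an odd number of zero-sum free rows. -/

section RowFactorization

variable {V : Type*} [AddCommGroup V] [Module (ZMod 2) V]

/-- If a zero-sum subsequence contains `e`, its complement lies in `A` and has sum zero, hence is
empty. -/
theorem ZeroSumFree.isMinZeroSum_cons {A : Multiset V} {e : V} (hA : ZeroSumFree A)
    (hs : A.sum = e) : IsMinZeroSum (e ::ₘ A) := by
  refine ⟨by simp, by rw [Multiset.sum_cons, hs, ZModModule.add_self], fun t ht h0 hne => ?_⟩
  by_cases he : e ∈ t
  · obtain ⟨t', rfl⟩ := Multiset.exists_cons_of_mem he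
    rw [Multiset.cons_le_cons_iff] at ht
    obtain ⟨t'', rfl⟩ := Multiset.le_iff_exists_add.1 ht
    rw [Multiset.sum_cons] at h0
    have h1 : t'.sum = e := add_left_cancel (h0.trans (ZModModule.add_self e).symm)
    rw [Multiset.sum_add, h1, add_eq_left] at hs
    rw [hA t'' (Multiset.le_add_left _ _) hs, add_zero]
  · rw [Multiset.le_cons_of_notMem he] at ht
    exact absurd (hA t ht h0) hne

/-- Contracting a nonzero vector `e` in a family of zero-sum free rows: each row loses at most one
subsequence with sum `e` and is then zero-sum free modulo `e`. -/
theorem exists_row_split [DecidableEq V] {rows : Multiset (Multiset V)}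
    (h : ∀ w ∈ rows, ZeroSumFree w) {e : V} (he : e ≠ 0) :
    ∃ (x : ℕ) (As Rs : Multiset (Multiset V)),
      rows.sum = Multiset.replicate x e + As.sum + Rs.sum ∧ Rs.card = rows.card ∧
      x + As.card ≤ rows.card ∧
      (∀ A ∈ As, A.sum = e ∧ 2 ≤ A.card ∧ ZeroSumFree A) ∧
      (∀ R ∈ Rs, ∀ t ≤ R, t.sum = 0 ∨ t.sum = e → t = 0) ∧
      rows.sum.count e = x := by
  induction rows using Multiset.induction_on with
  | empty => exact ⟨0, 0, 0, by simp⟩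
  | cons w rows ih =>
    obtain ⟨x, As, Rs, h1, h2, h3, h4, h5, h6⟩ := ih fun a ha => h a (by simp [ha])
    have hw := h w (by simp)
    by_cases hA : ∃ A ≤ w, A.sum = e
    · obtain ⟨A, hAw, hAe⟩ := hA
      obtain ⟨R, rfl⟩ := Multiset.le_iff_exists_add.1 hAw
      -- Two disjoint subsequences of sum `e` in one row would together sum to zero.
      have hR : ∀ t ≤ R, t.sum = 0 ∨ t.sum = e → t = 0 := by
        rintro t ht (h0 | h0)
        · exact hw t (ht.trans (Multiset.le_add_left _ _)) h0
        · have := hw (A + t) (add_le_add_right ht A)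
            (by rw [Multiset.sum_add, hAe, h0, ZModModule.add_self])
          simp only [add_eq_zero] at this
          exact this.2
      have hAf : ZeroSumFree A := hw.mono (Multiset.le_add_right _ _)
      have heR : e ∉ R := fun hm => by
        have := hR {e} (Multiset.singleton_le.2 hm) (by simp)
        simp at this
      have hRs : ∀ S ∈ R ::ₘ Rs, ∀ t ≤ S, t.sum = 0 ∨ t.sum = e → t = 0 := by
        intro S hS
        rcases Multiset.mem_cons.1 hS with rfl | hS
        · exact hR
        · exact h5 S hS
      have hc : A.card ≠ 0 := fun hc => he (by
        rw [← hAe, Multiset.card_eq_zero.1 hc, Multiset.sum_zero])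
      by_cases hc2 : 2 ≤ A.card
      · refine ⟨x, A ::ₘ As, R ::ₘ Rs, ?_, by simp [h2], by simp; omega, ?_, hRs, ?_⟩
        · simp only [Multiset.sum_cons, h1]
          abel
        · intro B hB
          rcases Multiset.mem_cons.1 hB with rfl | hB
          · exact ⟨hAe, hc2, hAf⟩
          · exact h4 B hB
        · rw [Multiset.sum_cons, Multiset.count_add, Multiset.count_add, h6,
            Multiset.count_eq_zero_of_notMem heR,
            Multiset.count_eq_zero_of_notMem (hAf.notMem_of_sum_eq hAe hc2)]
          simp
      · have hc1 : A.card = 1 := by omega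
        obtain ⟨a, rfl⟩ := Multiset.card_eq_one.1 hc1
        rw [Multiset.sum_singleton] at hAe
        subst hAe
        refine ⟨x + 1, As, R ::ₘ Rs, ?_, by simp [h2], by simp; omega, h4, hRs, ?_⟩
        · rw [Multiset.sum_cons, Multiset.sum_cons, h1, Multiset.replicate_succ,
            ← Multiset.singleton_add]
          abel
        · rw [Multiset.sum_cons, Multiset.count_add, Multiset.count_add, h6,
            Multiset.count_eq_zero_of_notMem heR]
          simp
          omega
    · push Not at hA
      refine ⟨x, As, w ::ₘ Rs, ?_, by simp [h2], by simp; omega, h4, ?_, ?_⟩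
      · simp only [Multiset.sum_cons, h1]
        abel
      · intro S hS t ht h0
        rcases Multiset.mem_cons.1 hS with rfl | hS
        · rcases h0 with h0 | h0
          · exact hw t ht h0
          · exact absurd h0 (hA t ht)
        · exact h5 S hS t ht h0
      · rw [Multiset.sum_cons, Multiset.count_add, h6, Multiset.count_eq_zero_of_notMem]
        · simp
        · intro hm
          exact hA {e} (Multiset.singleton_le.2 hm) (by simp)

theorem mk_span_singleton_eq_zero {e x : V} :
    (Submodule.Quotient.mk x : V ⧸ Submodule.span (ZMod 2) {e}) = 0 ↔ x = 0 ∨ x = e := by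
  rw [Submodule.Quotient.mk_eq_zero, Submodule.mem_span_singleton]
  constructor
  · rintro ⟨a, rfl⟩
    have : ∀ a : ZMod 2, a = 0 ∨ a = 1 := by decide
    rcases this a with rfl | rfl <;> simp
  · rintro (rfl | rfl)
    · exact ⟨0, by simp⟩
    · exact ⟨1, by simp⟩

theorem sum_map_mk_eq_zero {e : V} {t : Multiset V} :
    (t.map (Submodule.Quotient.mk : V → V ⧸ Submodule.span (ZMod 2) {e})).sum = 0 ↔
      t.sum = 0 ∨ t.sum = e := by
  rw [← mk_span_singleton_eq_zero]
  have := map_multiset_sum (Submodule.mkQ (Submodule.span (ZMod 2) {e})) t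
  simp only [Submodule.mkQ_apply] at this
  rw [this]
  exact Iff.rfl

/-- Enough circuits through `e` shorten a factorization. -/
theorem exists_isFact_of_circuits {W : Multiset V} (hW : W.sum = 0) (h0 : (0 : V) ∉ W)
    {e : V} {Y : Multiset (Multiset V)}
    (hY : ∀ A ∈ Y, A.sum = e ∧ 2 ≤ A.card ∧ ZeroSumFree A)
    (hle : (Y.map fun A => e ::ₘ A).sum ≤ W) :
    ∃ z, IsFact id W z ∧ 2 * z.card + Y.card ≤ W.card := by
  obtain ⟨W', rfl⟩ := Multiset.le_iff_exists_add.1 hle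
  have hYf : IsFact id (Y.map fun A => e ::ₘ A).sum (Y.map fun A => e ::ₘ A) := by
    refine ⟨rfl, fun a ha => ?_⟩
    obtain ⟨A, hA, rfl⟩ := Multiset.mem_map.1 ha
    rw [Multiset.map_id]
    exact (hY A hA).2.2.isMinZeroSum_cons (hY A hA).1
  have hYs := hYf.sum_map_eq_zero
  rw [Multiset.map_id] at hYs
  rw [Multiset.sum_add, hYs, zero_add] at hW
  obtain ⟨z, hz⟩ := exists_isFact id W' (by simpa using hW)
  refine ⟨_, hYf.add hz, ?_⟩
  have h1 := hz.two_mul_card_le fun h => h0 (Multiset.mem_add.2 (Or.inr (by simpa using h)))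
  -- Each circuit has length at least 3 while all other atoms have length at least 2, so every
  -- circuit saves one unit in `2|z| ≤ |W|`.
  have h2 := Multiset.mul_card_le_card_sum (k := 3) (z := Y.map fun A => e ::ₘ A) (by
    intro a ha
    obtain ⟨A, hA, rfl⟩ := Multiset.mem_map.1 ha
    have := (hY A hA).2.1
    simp; omega)
  simp only [Multiset.card_map] at h2
  simp only [Multiset.card_add, Multiset.card_map]
  omega

/-- A nonempty zero-sum subsequence has zero image modulo `e`, so by minimality it is all of `b`;
but `b` sums to `e ≠ 0`. -/
theorem IsMinZeroSum.zeroSumFree_of_map_mk {e : V} (he : e ≠ 0) {b : Multiset V}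
    (hb : IsMinZeroSum (b.map (Submodule.Quotient.mk : V → V ⧸ Submodule.span (ZMod 2) {e})))
    (hs : b.sum = e) : ZeroSumFree b := by
  intro t ht h0
  by_contra hne
  have := hb.eq_of_le _ (Multiset.map_le_map ht) (sum_map_mk_eq_zero.2 (Or.inl h0)) (by simpa)
  have hc := congrArg Multiset.card this
  simp only [Multiset.card_map] at hc
  rw [Multiset.eq_of_le_of_card_le ht hc.ge] at h0
  exact he (hs.symm.trans h0)

theorem IsMinZeroSum.of_map_mk {e : V} {b : Multiset V}
    (hb : IsMinZeroSum (b.map (Submodule.Quotient.mk : V → V ⧸ Submodule.span (ZMod 2) {e})))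
    (hs : b.sum = 0) : IsMinZeroSum b := by
  refine ⟨fun h => hb.ne_zero (by simp [h]), hs, fun t ht h0 hne => ?_⟩
  have := hb.eq_of_le _ (Multiset.map_le_map ht) (sum_map_mk_eq_zero.2 (Or.inl h0)) (by simpa)
  have hc := congrArg Multiset.card this
  simp only [Multiset.card_map] at hc
  exact Multiset.eq_of_le_of_card_le ht hc.ge

/-- The concatenation of an odd number `N` of zero-sum free sequences over an elementary `2`-group
of rank `r` has, if it sums to zero, a factorization of length at most `(N - 1) r / 2`, or one that
is shorter than the trivial bound by `(N - 2) / 2`. -/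
theorem exists_short_isFact_of_odd (n : ℕ) : ∀ (V : Type*) [AddCommGroup V] [Module (ZMod 2) V]
    [FiniteDimensional (ZMod 2) V], Module.finrank (ZMod 2) V = n →
    ∀ rows : Multiset (Multiset V), Odd rows.card → (∀ w ∈ rows, ZeroSumFree w) →
      rows.sum.sum = 0 →
      ∃ z, IsFact id rows.sum z ∧
        (2 * z.card + n ≤ rows.card * n ∨ 2 * z.card + rows.card ≤ rows.sum.card + 2) := by
  classical
  induction n with
  | zero =>
    intro V _ _ _ hV rows _ hrows _
    have hW : rows.sum = 0 := by
      rw [← Multiset.card_eq_zero]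
      have := Multiset.card_sum_le_mul_card (k := 0) (z := rows) fun a ha =>
        hV ▸ (hrows a ha).card_le
      omega
    exact ⟨0, by rw [hW]; exact ⟨by simp, by simp⟩, Or.inl (by simp)⟩
  | succ n ih =>
    intro V _ _ _ hV rows hodd hrows hsum
    have hNpos : 1 ≤ rows.card := hodd.pos
    have h0 : (0 : V) ∉ rows.sum := fun h => by
      obtain ⟨w, hw, h⟩ := Multiset.mem_sum_multiset.1 h
      exact (hrows w hw).zero_notMem h
    have hWcard : rows.sum.card ≤ (n + 1) * rows.card :=
      Multiset.card_sum_le_mul_card fun a ha => hV ▸ (hrows a ha).card_le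
    by_cases hW : rows.sum = 0
    · refine ⟨0, by rw [hW]; exact ⟨by simp, by simp⟩, Or.inl ?_⟩
      simp only [Multiset.card_zero]
      nlinarith
    -- A vector of maximal multiplicity: either all multiplicities are at most `N - 3`, where `N` is
    -- the number of rows, or `e` occurs at least `N - 2` times.
    obtain ⟨e, heW, hmax⟩ := Finset.exists_max_image rows.sum.toFinset (fun x => rows.sum.count x)
      (by simpa using hW)
    rw [Multiset.mem_toFinset] at heW
    have he : e ≠ 0 := fun h => h0 (h ▸ heW)
    have hmax' : ∀ x, rows.sum.count x ≤ rows.sum.count e := fun x => by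
      by_cases hx : x ∈ rows.sum
      · exact hmax x (by simpa using hx)
      · rw [Multiset.count_eq_zero_of_notMem hx]; exact Nat.zero_le _
    by_cases hlarge : rows.sum.count e + 3 ≤ rows.card
    -- With `b ≤ N - 3` and `|W| ≤ N(n + 1)`, the count bound reads `6|z| ≤ 3(N - 1)(n + 1)`.
    · obtain ⟨z, hz, hzc⟩ := exists_isFact_of_count_le hsum h0 hmax'
      refine ⟨z, hz, Or.inl ?_⟩
      rw [hV] at hzc
      have h1 := Nat.mul_le_mul_right (n + 1) hlarge
      nlinarith
    obtain ⟨x, As, Rs, hdec, hRcard, hxA, hA, hR, hcount⟩ := exists_row_split hrows he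
    rw [hcount] at hlarge
    let mk : V → V ⧸ Submodule.span (ZMod 2) {e} := Submodule.Quotient.mk
    have hQ : Module.finrank (ZMod 2) (V ⧸ Submodule.span (ZMod 2) {e}) = n := by
      have := Submodule.finrank_quotient_add_finrank (Submodule.span (ZMod 2) {e})
      rw [finrank_span_singleton he, hV] at this
      omega
    have hAs : As.sum.sum = As.card • e := Multiset.sum_sum_eq_card_nsmul fun a ha => (hA a ha).1
    have hRsum : (Rs.sum.map mk).sum = 0 := by
      have h1 : ((rows.sum).map mk).sum = 0 := sum_map_mk_eq_zero.2 (Or.inl hsum)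
      rw [hdec, Multiset.map_add, Multiset.map_add, Multiset.sum_add, Multiset.sum_add,
        sum_map_mk_eq_zero.2 (by simpa using nsmul_eq_zero_or_self e x), sum_map_mk_eq_zero.2 (hAs ▸ nsmul_eq_zero_or_self e _)] at h1
      simpa using h1
    -- The remainders stay zero-sum free modulo `e`, still in `N` rows, and the rank has dropped by
    -- one.
    obtain ⟨zq, hzq, hzqc⟩ := ih (V ⧸ Submodule.span (ZMod 2) {e}) hQ (Rs.map (Multiset.map mk))
      (by rwa [Multiset.card_map, hRcard])
      (by
        intro w hw
        obtain ⟨R, hRm, rfl⟩ := Multiset.mem_map.1 hw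
        intro t ht h0
        obtain ⟨S, hS, rfl⟩ := Multiset.exists_map_eq_of_le ht
        rw [hR R hRm S hS (sum_map_mk_eq_zero.1 h0), Multiset.map_zero])
      (by rw [← Multiset.map_sum_multiset]; exact hRsum)
    rw [← Multiset.map_sum_multiset] at hzq hzqc
    rw [Multiset.card_map, Multiset.card_map, hRcard] at hzqc
    obtain ⟨y, hy, rfl⟩ := Multiset.exists_lift_sum hzq.sum_eq.symm
    rw [Multiset.card_map] at hzqc
    have hyat : ∀ b ∈ y, IsMinZeroSum (b.map mk) := fun b hb => by
      simpa using hzq.atom _ (Multiset.mem_map_of_mem _ hb)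
    have hy2 : ∀ b ∈ y, 2 ≤ b.card := by
      intro b hb
      have := (hyat b hb).two_le_card ?_
      · simpa using this
      intro hm
      obtain ⟨v, hv, hv0⟩ := Multiset.mem_map.1 hm
      have hvR : v ∈ Rs.sum := hy ▸ Multiset.mem_sum_multiset.2 ⟨b, hb, hv⟩
      obtain ⟨R, hRm, hvR⟩ := Multiset.mem_sum_multiset.1 hvR
      have := hR R hRm {v} (Multiset.singleton_le.2 hvR)
        (by simpa using mk_span_singleton_eq_zero.1 hv0)
      simp at this
    -- Lifted atoms sum to `0` or to `e`: the former are atoms already, the latter need one copy of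
    -- `e` each, as do the members of `As`.
    have hsplit := Multiset.filter_add_not (fun a : Multiset V => a.sum = 0) y
    set Z0 := y.filter (fun a => a.sum = 0) with hZ0
    set Z1 := y.filter (fun a => ¬ a.sum = 0) with hZ1
    have hZ1e : ∀ A ∈ Z1, A.sum = e ∧ 2 ≤ A.card ∧ ZeroSumFree A := by
      intro A hAm
      rw [hZ1, Multiset.mem_filter] at hAm
      have hs := (sum_map_mk_eq_zero.1 (hyat A hAm.1).sum_eq).resolve_left hAm.2
      exact ⟨hs, hy2 A hAm.1, (hyat A hAm.1).zeroSumFree_of_map_mk he hs⟩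
    have hY : ∀ A ∈ As + Z1, A.sum = e ∧ 2 ≤ A.card ∧ ZeroSumFree A := by
      intro A hAm
      rcases Multiset.mem_add.1 hAm with h | h
      · exact hA A h
      · exact hZ1e A h
    have hZ0f : IsFact id Z0.sum Z0 := by
      refine ⟨rfl, fun a ha => ?_⟩
      rw [hZ0, Multiset.mem_filter] at ha
      rw [Multiset.map_id]
      exact (hyat a ha.1).of_map_mk ha.2
    have hconsum : ∀ Y : Multiset (Multiset V),
        (Y.map fun A => e ::ₘ A).sum = Multiset.replicate Y.card e + Y.sum := by
      intro Y
      induction Y using Multiset.induction_on with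
      | empty => simp
      | cons a Y ih =>
        rw [Multiset.map_cons, Multiset.sum_cons, ih, Multiset.card_cons, Multiset.sum_cons,
          Multiset.replicate_succ, ← Multiset.singleton_add, ← Multiset.singleton_add]
        abel
    have hWdec : rows.sum = Multiset.replicate x e + (As + Z1).sum + Z0.sum := by
      rw [hdec, ← hy, ← hsplit]
      simp only [Multiset.sum_add]
      abel
    -- If the copies of `e` run out first, all `x ≥ N - 2` of them are used in circuits, which gives
    -- the second alternative directly.
    by_cases hxy : x < (As + Z1).card
    · obtain ⟨Y, hYle, hYc⟩ := Multiset.exists_le_card_eq hxy.le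
      obtain ⟨z, hz, hzc⟩ := exists_isFact_of_circuits hsum h0 (e := e) (Y := Y)
        (fun A hAm => hY A (Multiset.mem_of_le hYle hAm)) (by
          rw [hconsum, hWdec, hYc]
          refine le_trans ?_ (Multiset.le_add_right _ _)
          exact add_le_add_right (Multiset.sum_le_sum_of_le hYle) _)
      exact ⟨z, hz, Or.inr (by omega)⟩
    push Not at hxy
    -- Since `W` sums to zero and `e ≠ 0`, the number of leftover copies of `e` is even, and they
    -- pair into squares.
    obtain ⟨k, hk⟩ : ∃ k, x = (As + Z1).card + 2 * k := by
      have h1 : rows.sum.sum = (x + (As + Z1).card) • e := by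
        have hZ0s := hZ0f.sum_map_eq_zero
        rw [Multiset.map_id] at hZ0s
        rw [hWdec, Multiset.sum_add, Multiset.sum_add, hZ0s, Multiset.sum_replicate,
          Multiset.sum_sum_eq_card_nsmul fun a ha => (hY a ha).1, add_smul, add_zero]
      obtain ⟨m, hm⟩ := even_of_nsmul_eq_zero he (h1.symm.trans hsum)
      exact ⟨m - (As + Z1).card, by omega⟩
    have hsq : IsFact id (Multiset.replicate (2 * k) e) (Multiset.replicate k {e, e}) := by
      refine ⟨?_, fun a ha => ?_⟩
      · have : ({e, e} : Multiset V) = Multiset.replicate 2 e := rfl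
        rw [Multiset.sum_replicate, this, Multiset.nsmul_replicate, mul_comm]
      · rw [Multiset.eq_of_mem_replicate ha, Multiset.map_id]
        exact isMinZeroSum_pair he
    have hcons : IsFact id ((As + Z1).map fun A => e ::ₘ A).sum
        ((As + Z1).map fun A => e ::ₘ A) := by
      refine ⟨rfl, fun a ha => ?_⟩
      obtain ⟨A, hA, rfl⟩ := Multiset.mem_map.1 ha
      rw [Multiset.map_id]
      exact (hY A hA).2.2.isMinZeroSum_cons (hY A hA).1
    have hfin := (hcons.add hsq).add hZ0f
    have hWeq : ((As + Z1).map fun A => e ::ₘ A).sum + Multiset.replicate (2 * k) e + Z0.sum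
        = rows.sum := by
      rw [hWdec, hconsum, hk, Multiset.replicate_add]
      abel
    rw [hWeq] at hfin
    refine ⟨_, hfin, ?_⟩
    have hyc : y.card = Z0.card + Z1.card := by rw [← hsplit, Multiset.card_add]
    have hAc : 2 * As.card ≤ As.sum.card := Multiset.mul_card_le_card_sum fun a ha => (hA a ha).2.1
    have hWc : rows.sum.card = x + As.sum.card + Rs.sum.card := by rw [hdec]; simp
    simp only [Multiset.card_add, Multiset.card_map, Multiset.card_replicate] at hk ⊢
    -- The new length is `|y| + |As| + k`, where `2|As| + 2k ≤ x + |As| ≤ rows.card`. The left side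
    -- is even and `rows.card` is odd, so one more unit is gained, exactly what the first
    -- alternative needs when the rank rises from `n` to `n + 1`.
    obtain ⟨N, hN⟩ := hodd
    rcases hzqc with h | h
    · left
      have := mul_add rows.card n 1
      omega
    · right
      omega

end RowFactorization

/-! ### Distances, tame bounds and minimal configurations. -/

open Classical in
/-- The distance of two multisets. -/
def multisetDist {α : Type*} (z z' : Multiset α) : ℕ :=
  max (z - z ∩ z').card (z' - z ∩ z').card

theorem multisetDist_self {α : Type*} (z : Multiset α) : multisetDist z z = 0 := by
  classical
  have : z ∩ z = z := inf_idem z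
  simp [multisetDist, this]

theorem multisetDist_add_right_le {α : Type*} (z z' y : Multiset α) :
    multisetDist (z + y) (z' + y) ≤ max z.card z'.card := by
  classical
  unfold multisetDist
  have h := Multiset.card_le_card
    (Multiset.le_inter (Multiset.le_add_left y z) (Multiset.le_add_left y z'))
  rw [Multiset.card_sub Multiset.inter_le_left, Multiset.card_sub Multiset.inter_le_right,
    Multiset.card_add, Multiset.card_add]
  have h' : y.card ≤ ((z + y) ∩ (z' + y)).card := by convert h
  omega

theorem multisetDist_eq_of_disjoint {α : Type*} {z z' : Multiset α} (h : ∀ a ∈ z, a ∉ z') :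
    multisetDist z z' = max z.card z'.card := by
  classical
  have : z ∩ z' = 0 := Multiset.inter_eq_zero_iff_disjoint.2 (Multiset.disjoint_left.2 (h _))
  unfold multisetDist
  simp only [this, Multiset.sub_zero]

theorem multisetDist_map {α β : Type*} {f : α → β} (hf : Function.Injective f)
    (z z' : Multiset α) : multisetDist (z.map f) (z'.map f) = multisetDist z z' := by
  classical
  have : z.map f ∩ z'.map f = (z ∩ z').map f := by
    ext b
    by_cases hb : ∃ a, f a = b
    · obtain ⟨a, rfl⟩ := hb
      simp only [Multiset.count_inter, Multiset.count_map_eq_count' f _ hf]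
    · have : ∀ y : Multiset α, (y.map f).count b = 0 := fun y =>
        Multiset.count_eq_zero_of_notMem fun hm => by
          obtain ⟨a, _, ha⟩ := Multiset.mem_map.1 hm
          exact hb ⟨a, ha⟩
      simp [this]
  unfold multisetDist
  rw [Multiset.card_sub (by convert Multiset.inter_le_left),
    Multiset.card_sub (by convert Multiset.inter_le_right),
    Multiset.card_sub Multiset.inter_le_left, Multiset.card_sub Multiset.inter_le_right]
  have h2 := congrArg Multiset.card this
  simp only [Multiset.card_map] at h2 ⊢
  have h3 : (Multiset.map f z ∩ Multiset.map f z').card = (z ∩ z').card := by convert h2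
  rw [h2]

/-- `N` bounds the tame degree of the monoid of sequences over `P` whose image under `c` has
sum zero. -/
def TameBound {P V : Type*} [AddCommGroup V] (c : P → V) (N : ℕ∞) : Prop :=
  ∀ (u : Multiset P) (z : Multiset (Multiset P)), IsMinZeroSum (u.map c) →
    (∀ v ∈ z, IsMinZeroSum (v.map c)) → u ≤ z.sum →
    ∃ z', IsFact c z.sum z' ∧ u ∈ z' ∧ (multisetDist z z' : ℕ∞) ≤ N

/-- The pairs `(uᵢ, wᵢ)` in `D` describe a product of atoms `vᵢ = uᵢ + wᵢ` that is divisible by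
the atom `u = ∑ uᵢ`, while no proper subproduct is. -/
structure IsTameConfig {P V : Type*} [AddCommGroup V] (c : P → V)
    (D : Multiset (Multiset P × Multiset P)) : Prop where
  left_ne_zero : ∀ p ∈ D, p.1 ≠ 0
  atom : ∀ p ∈ D, IsMinZeroSum ((p.1 + p.2).map c)
  sum_left : IsMinZeroSum ((D.map Prod.fst).sum.map c)
  minimal : ∀ p D', D = p ::ₘ D' → ¬ (D.map Prod.fst).sum ≤ (D'.map fun q => q.1 + q.2).sum

/-- Greedy choice: each factor in turn absorbs as much of the remaining part of `u` as it can. -/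
theorem Multiset.exists_split_of_le_sum {P : Type*} {u : Multiset P} {z : Multiset (Multiset P)}
    (h : u ≤ z.sum) : ∃ D : Multiset (Multiset P × Multiset P),
      (D.map fun p => p.1 + p.2) = z ∧ (D.map Prod.fst).sum = u := by
  classical
  induction z using Multiset.induction_on generalizing u with
  | empty => exact ⟨0, by simp, by simpa [eq_comm] using h⟩
  | cons v z ih =>
    rw [Multiset.sum_cons] at h
    obtain ⟨D, rfl, hD⟩ := ih (u := u - v) (by rwa [Multiset.sub_le_iff_le_add'])
    refine ⟨(u ∩ v, v - u ∩ v) ::ₘ D, ?_, ?_⟩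
    · rw [Multiset.map_cons, add_tsub_cancel_of_le (Multiset.inter_le_right)]
    · rw [Multiset.map_cons, Multiset.sum_cons, hD, add_comm, Multiset.sub_add_inter]

/-! ### Reduction to minimal configurations. -/

section Reduced

variable {P V : Type*} [AddCommGroup V] {c : P → V} {N : ℕ∞}

/-- Take a subproduct with the fewest factors that is still divisible by `u`. The factors outside it
are kept in both factorizations and do not affect the distance, so only `|D|` and `|y| + 1` matter,
the `1` accounting for `u` itself. -/
theorem tameBound_of_reduced
    (h : ∀ D, IsTameConfig c D → ∃ y, IsFact c (D.map Prod.snd).sum y ∧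
      (D.card : ℕ∞) ≤ N ∧ ((y.card + 1 : ℕ) : ℕ∞) ≤ N) : TameBound c N := by
  intro u z hu hz huz
  classical
  have hex : ∃ n, ∃ z0 ≤ z, u ≤ z0.sum ∧ z0.card = n := ⟨_, z, le_rfl, huz, rfl⟩
  obtain ⟨z0, hz0, huz0, hn⟩ := Nat.find_spec hex
  have hmin : ∀ z1 ≤ z0, z1.card < z0.card → ¬ u ≤ z1.sum := fun z1 h1 hlt hle =>
    Nat.find_min hex (m := z1.card) (by omega) ⟨z1, h1.trans hz0, hle, rfl⟩
  obtain ⟨D, hD, hDu⟩ := Multiset.exists_split_of_le_sum huz0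
  have hred : IsTameConfig c D := by
    have hminD : ∀ p D', D = p ::ₘ D' →
        ¬ (D.map Prod.fst).sum ≤ (D'.map fun q => q.1 + q.2).sum := by
      rintro p D' rfl
      rw [hDu]
      refine hmin _ ?_ ?_
      · rw [← hD, Multiset.map_cons]
        exact Multiset.le_cons_self _ _
      · rw [← hD]
        simp
    refine ⟨fun p hp h0 => ?_, fun p hp => ?_, hDu ▸ hu, hminD⟩
    · obtain ⟨D', rfl⟩ := Multiset.exists_cons_of_mem hp
      refine hminD p D' rfl ?_
      rw [Multiset.map_cons, Multiset.sum_cons, h0, zero_add, Multiset.sum_map_add]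
      exact Multiset.le_add_right _ _
    · exact hz _ (Multiset.mem_of_le hz0 (hD ▸ Multiset.mem_map_of_mem _ hp))
  obtain ⟨y, hy, hDN, hyN⟩ := h D hred
  obtain ⟨z1, rfl⟩ := Multiset.le_iff_exists_add.1 hz0
  refine ⟨(u ::ₘ y) + z1, ⟨?_, ?_⟩, by simp, ?_⟩
  · rw [Multiset.sum_add, Multiset.sum_add, Multiset.sum_cons, hy.sum_eq, ← hDu, ← hD,
      Multiset.sum_map_add]
  · intro a ha
    rcases Multiset.mem_add.1 ha with ha | ha
    · rcases Multiset.mem_cons.1 ha with rfl | ha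
      · exact hu
      · exact hy.atom a ha
    · exact hz a (Multiset.mem_add.2 (Or.inr ha))
  · have := multisetDist_add_right_le z0 (u ::ₘ y) z1
    rw [← hD, Multiset.card_map, Multiset.card_cons] at this
    rcases le_max_iff.1 this with h | h
    · rw [← hD]
      exact (Nat.cast_le.2 h).trans hDN
    · rw [← hD]
      exact (Nat.cast_le.2 h).trans hyN

namespace IsTameConfig

variable {D : Multiset (Multiset P × Multiset P)}

theorem free (hD : IsTameConfig c D) {p : Multiset P × Multiset P} (hp : p ∈ D) :
    ZeroSumFree (p.2.map c) := by
  refine (hD.atom p hp).zeroSumFree (lt_of_le_of_ne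
    (Multiset.map_le_map (Multiset.le_add_left _ _)) fun h => ?_)
  have := congrArg Multiset.card h
  have hpos := Multiset.card_pos.2 (hD.left_ne_zero p hp)
  simp only [Multiset.card_map, Multiset.card_add] at this
  omega

theorem card_le_card_left (hD : IsTameConfig c D) : D.card ≤ (D.map Prod.fst).sum.card := by
  have := Multiset.mul_card_le_card_sum (k := 1) (z := D.map Prod.fst) (by
    intro a ha
    obtain ⟨p, hp, rfl⟩ := Multiset.mem_map.1 ha
    exact Multiset.card_pos.2 (hD.left_ne_zero p hp))
  simpa using this

theorem left_card_eq_one (hD : IsTameConfig c D) (h : (D.map Prod.fst).sum.card = D.card)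
    {p : Multiset P × Multiset P} (hp : p ∈ D) : p.1.card = 1 := by
  have hpos := Multiset.card_pos.2 (hD.left_ne_zero p hp)
  obtain ⟨D', rfl⟩ := Multiset.exists_cons_of_mem hp
  have := Multiset.mul_card_le_card_sum (k := 1) (z := D'.map Prod.fst) (by
    intro a ha
    obtain ⟨q, hq, rfl⟩ := Multiset.mem_map.1 ha
    exact Multiset.card_pos.2 (hD.left_ne_zero q (by simp [hq])))
  simp at h this
  omega

theorem sum_right (hD : IsTameConfig c D) : ((D.map Prod.snd).sum.map c).sum = 0 := by
  have h1 : (((D.map fun p : Multiset P × Multiset P => p.1 + p.2).sum).map c).sum = 0 :=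
    IsFact.sum_map_eq_zero ⟨rfl, fun a ha => by
      obtain ⟨p, hp, rfl⟩ := Multiset.mem_map.1 ha
      exact hD.atom p hp⟩
  rw [Multiset.sum_map_add, Multiset.map_add, Multiset.sum_add] at h1
  have h2 := hD.sum_left.sum_eq
  rw [h2, zero_add] at h1
  exact h1

theorem zero_notMem_right (hD : IsTameConfig c D) : (0 : V) ∉ (D.map Prod.snd).sum.map c := by
  intro h
  obtain ⟨x, hx, hx0⟩ := Multiset.mem_map.1 h
  obtain ⟨w, hw, hxw⟩ := Multiset.mem_sum_multiset.1 hx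
  obtain ⟨p, hp, rfl⟩ := Multiset.mem_map.1 hw
  exact (hD.free hp).zero_notMem (hx0 ▸ Multiset.mem_map_of_mem c hxw)

theorem exists_isFact_right (hD : IsTameConfig c D) :
    ∃ y, IsFact c (D.map Prod.snd).sum y ∧ 2 * y.card ≤ (D.map Prod.snd).sum.card := by
  obtain ⟨y, hy⟩ := exists_isFact c _ hD.sum_right
  exact ⟨y, hy, hy.two_mul_card_le hD.zero_notMem_right⟩

end IsTameConfig

end Reduced

/-! ### Configurations over an elementary `2`-group and the even rank bound. -/

section ReducedCharTwo

variable {P V : Type*} [AddCommGroup V] [Module (ZMod 2) V] [FiniteDimensional (ZMod 2) V]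
  {c : P → V} {N : ℕ∞} {D : Multiset (Multiset P × Multiset P)}

theorem exists_short_isFact_over {rows : Multiset (Multiset P)} (hodd : Odd rows.card)
    (hrows : ∀ w ∈ rows, ZeroSumFree (w.map c)) (hsum : (rows.sum.map c).sum = 0) :
    ∃ z, IsFact c rows.sum z ∧
      (2 * z.card + Module.finrank (ZMod 2) V ≤ rows.card * Module.finrank (ZMod 2) V ∨
        2 * z.card + rows.card ≤ rows.sum.card + 2) := by
  obtain ⟨z, hz, hzc⟩ := exists_short_isFact_of_odd _ V rfl (rows.map (Multiset.map c))
    (by simpa using hodd) (by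
      intro w hw
      obtain ⟨a, ha, rfl⟩ := Multiset.mem_map.1 hw
      exact hrows a ha) (by rwa [← Multiset.map_sum_multiset])
  rw [← Multiset.map_sum_multiset] at hz hzc
  obtain ⟨y, hy, hyc⟩ := hz.exists_lift
  refine ⟨y, hy, ?_⟩
  rw [hyc]
  simpa using hzc

namespace IsTameConfig

theorem left_card_le (hD : IsTameConfig c D) :
    (D.map Prod.fst).sum.card ≤ Module.finrank (ZMod 2) V + 1 := by
  simpa using hD.sum_left.card_le

theorem card_left_add_card_right_le (hD : IsTameConfig c D) :
    (D.map Prod.fst).sum.card + (D.map Prod.snd).sum.card ≤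
      (Module.finrank (ZMod 2) V + 1) * D.card := by
  have := Multiset.card_sum_le_mul_card (z := D.map fun p => p.1 + p.2)
    (k := Module.finrank (ZMod 2) V + 1) (by
      intro a ha
      obtain ⟨p, hp, rfl⟩ := Multiset.mem_map.1 ha
      simpa using (hD.atom p hp).card_le)
  rw [Multiset.sum_map_add] at this
  simpa using this

theorem exists_short (hD : IsTameConfig c D) (hodd : Odd D.card) :
    ∃ y, IsFact c (D.map Prod.snd).sum y ∧
      (2 * y.card + Module.finrank (ZMod 2) V ≤ D.card * Module.finrank (ZMod 2) V ∨
        2 * y.card + D.card ≤ (D.map Prod.snd).sum.card + 2) := by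
  have := exists_short_isFact_over (c := c) (rows := D.map Prod.snd) (by simpa using hodd) (by
      intro w hw
      obtain ⟨p, hp, rfl⟩ := Multiset.mem_map.1 hw
      exact hD.free hp) hD.sum_right
  simpa using this

end IsTameConfig

/-- With at most `r` rows, `|W| ≤ r²` and halving suffices. The only other case is `r + 1` rows, an
odd number, to which the row theorem applies. -/
theorem tameBound_of_even {r : ℕ} (hr : Module.finrank (ZMod 2) V = r) (h2 : 2 ≤ r)
    (heven : Even r) : TameBound c ((1 + r ^ 2 / 2 : ℕ) : ℕ∞) := by
  refine tameBound_of_reduced fun D hD => ?_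
  have hm := hD.card_le_card_left
  have hu := hD.left_card_le
  have hW := hD.card_left_add_card_right_le
  rw [hr] at hu hW
  obtain ⟨k, hk⟩ := heven
  have hdiv : r ^ 2 / 2 = 2 * k * k :=
    Nat.div_eq_of_eq_mul_left two_pos (by rw [hk]; ring)
  have hDN : D.card ≤ 1 + r ^ 2 / 2 := by
    rw [hdiv]
    nlinarith
  by_cases hmr : D.card ≤ r
  · obtain ⟨y, hy, hyc⟩ := hD.exists_isFact_right
    refine ⟨y, hy, by exact_mod_cast hDN, ?_⟩
    have : 2 * y.card ≤ r * r := by nlinarith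
    rw [hdiv]
    norm_cast
    subst hk
    nlinarith
  · have hmr' : D.card = r + 1 := by omega
    obtain ⟨y, hy, hyc⟩ := hD.exists_short (by rw [hmr', hk]; exact ⟨k, by ring⟩)
    refine ⟨y, hy, by exact_mod_cast hDN, ?_⟩
    rw [hr, hmr'] at hyc
    rw [hmr'] at hW hm
    rw [hdiv]
    norm_cast
    subst hk
    -- The second alternative only gives `2|y| ≤ r² + 1`; parity removes the excess.
    have : 2 * y.card ≤ 2 * (2 * k * k) + 1 := by
      rcases hyc with h | h <;> nlinarith
    omega

end ReducedCharTwo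

/-! ### The odd rank bound: separated configurations and an exchange. -/

section OddRank

variable {P V : Type*} [AddCommGroup V] [Module (ZMod 2) V] [FiniteDimensional (ZMod 2) V]
  {c : P → V} {D : Multiset (Multiset P × Multiset P)}

/-- No class occurring in some `uᵢ` occurs in a `wⱼ` with `j ≠ i`. -/
def IsSeparated (c : P → V) (D : Multiset (Multiset P × Multiset P)) : Prop :=
  ∀ p q D', D = p ::ₘ q ::ₘ D' → ∀ a ∈ p.1, ∀ b ∈ q.2, c a ≠ c b

namespace IsTameConfig

omit [Module (ZMod 2) V] [FiniteDimensional (ZMod 2) V] in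
theorem fst_eq_singleton (hD : IsTameConfig c D) (h : (D.map Prod.fst).sum.card = D.card)
    {p : Multiset P × Multiset P} (hp : p ∈ D) : ∃ a, p.1 = {a} :=
  Multiset.card_eq_one.1 (hD.left_card_eq_one h hp)

-- A class repeated in the minimal zero-sum sequence `u` would make it a square, of length 2.
omit [FiniteDimensional (ZMod 2) V] in
theorem left_ne (hD : IsTameConfig c D) (h3 : 3 ≤ (D.map Prod.fst).sum.card)
    {p q : Multiset P × Multiset P} {D' : Multiset (Multiset P × Multiset P)}
    (hdec : D = p ::ₘ q ::ₘ D') {a b : P} (ha : a ∈ p.1) (hb : b ∈ q.1) : c a ≠ c b := by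
  intro hab
  have hle : ({a, b} : Multiset P) ≤ (D.map Prod.fst).sum := by
    rw [hdec, Multiset.map_cons, Multiset.map_cons, Multiset.sum_cons, Multiset.sum_cons,
      ← add_assoc]
    refine le_trans ?_ (Multiset.le_add_right _ _)
    exact add_le_add (Multiset.singleton_le.2 ha) (Multiset.singleton_le.2 hb)
  have h2 := Multiset.map_le_map (f := c) hle
  have h4 : ({a, b} : Multiset P).map c = {c a, c a} := by simp [hab]
  rw [h4] at h2
  have := congrArg Multiset.card (hD.sum_left.eq_pair h2)
  simp at this
  omega

-- Passing to classes may create common factors that shrink the distance. Separation prevents this: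
-- the class of `uᵢ` occurs in no factor other than the `i`-th. Hence a factorization containing the
-- image of `u` shares no atom with the image of the product, and the bound over `V` controls its
-- full length.
omit [FiniteDimensional (ZMod 2) V] in
theorem exists_short_of_isSeparated {t : ℕ∞} (ht : TameBound (id : V → V) t)
    (hD : IsTameConfig c D) (h3 : 3 ≤ (D.map Prod.fst).sum.card)
    (hcard : (D.map Prod.fst).sum.card = D.card) (hsep : IsSeparated c D) :
    ∃ y, IsFact c (D.map Prod.snd).sum y ∧ ((y.card + 1 : ℕ) : ℕ∞) ≤ t := by
  set U := (D.map Prod.fst).sum.map c with hU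
  set Z := D.map fun p => (p.1 + p.2).map c with hZ
  have hZsum : Z.sum = U + (D.map Prod.snd).sum.map c := by
    have : Z = (D.map fun p => p.1 + p.2).map (Multiset.map c) := by
      rw [hZ, Multiset.map_map]
      rfl
    rw [this, ← Multiset.map_sum_multiset, Multiset.sum_map_add, Multiset.map_add]
  obtain ⟨z', hz', hUz', hd⟩ := ht U Z (by simpa using hD.sum_left) (by
    intro v hv
    obtain ⟨p, hp, rfl⟩ := Multiset.mem_map.1 hv
    simpa using hD.atom p hp) (by rw [hZsum]; exact Multiset.le_add_right _ _)
  -- If the image of the `i`-th factor were kept, `U` would have to divide the product of the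
  -- others, which lacks the class of `uᵢ`.
  have hdis : ∀ v ∈ Z, v ∉ z' := by
    intro v hv hvz'
    obtain ⟨p, hp, rfl⟩ := Multiset.mem_map.1 hv
    obtain ⟨D', hdec⟩ := Multiset.exists_cons_of_mem hp
    obtain ⟨a, ha⟩ := hD.fst_eq_singleton hcard hp
    have hother : ∀ q ∈ D', ∃ D'', D = p ::ₘ q ::ₘ D'' ∧ D = q ::ₘ p ::ₘ D'' := by
      intro q hq
      obtain ⟨D'', rfl⟩ := Multiset.exists_cons_of_mem hq
      exact ⟨D'', hdec, by rw [hdec, Multiset.cons_swap]⟩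
    have hne : U ≠ (p.1 + p.2).map c := by
      intro hEq
      have hD'0 : D' ≠ 0 := by
        rintro rfl
        rw [hcard, hdec] at h3
        simp at h3
      obtain ⟨q, hq⟩ := Multiset.exists_mem_of_ne_zero hD'0
      obtain ⟨D'', h1, h2⟩ := hother q hq
      have hqD : q ∈ D := by rw [h1]; simp
      obtain ⟨b, hb⟩ := hD.fst_eq_singleton hcard hqD
      have hbU : c b ∈ U := by
        refine Multiset.mem_map_of_mem c (Multiset.mem_sum_multiset.2
          ⟨q.1, Multiset.mem_map_of_mem _ hqD, by simp [hb]⟩)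
      rw [hEq] at hbU
      obtain ⟨x, hx, hxb⟩ := Multiset.mem_map.1 hbU
      rcases Multiset.mem_add.1 hx with hx | hx
      · exact hD.left_ne h3 h1 hx (b := b) (by simp [hb]) hxb
      · exact hsep q p D'' h2 b (by simp [hb]) x hx hxb.symm
    obtain ⟨y, rfl⟩ := Multiset.exists_cons_of_mem hvz'
    have hUy : U ∈ y := (Multiset.mem_cons.1 hUz').resolve_left hne
    have hsum := hz'.sum_eq
    rw [hZ, hdec, Multiset.map_cons, Multiset.sum_cons, Multiset.sum_cons,
      add_right_inj] at hsum
    have haU : c a ∈ U := by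
      refine Multiset.mem_map_of_mem c (Multiset.mem_sum_multiset.2
        ⟨p.1, Multiset.mem_map_of_mem _ hp, by simp [ha]⟩)
    have ha' := Multiset.mem_of_le (Multiset.le_sum_of_mem_multiset hUy) haU
    rw [hsum] at ha'
    obtain ⟨w, hw, haw⟩ := Multiset.mem_sum_multiset.1 ha'
    obtain ⟨q, hq, rfl⟩ := Multiset.mem_map.1 hw
    obtain ⟨D'', h1, h2⟩ := hother q hq
    obtain ⟨x, hx, hxa⟩ := Multiset.mem_map.1 haw
    rcases Multiset.mem_add.1 hx with hx | hx
    · exact hD.left_ne h3 h1 (a := a) (by simp [ha]) hx hxa.symm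
    · exact hsep p q D'' h1 a (by simp [ha]) x hx hxa.symm
  rw [multisetDist_eq_of_disjoint hdis] at hd
  obtain ⟨y, rfl⟩ := Multiset.exists_cons_of_mem hUz'
  have hy : IsFact id ((D.map Prod.snd).sum.map c) y := by
    refine ⟨?_, fun a ha => hz'.atom a (by simp [ha])⟩
    have := hz'.sum_eq
    rwa [hZsum, Multiset.sum_cons, add_right_inj] at this
  obtain ⟨y', hy', hyc⟩ := hy.exists_lift
  refine ⟨y', hy', le_trans ?_ hd⟩
  rw [hyc, ← Multiset.card_cons U y]
  exact_mod_cast le_max_right _ _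

/-- If `u_p` has the class of some `b` in `w_q`, then `b + w_p` is an atom. Splitting it off leaves
`w_q - b` and `r - 1` other rows, so `r` rows in all, an odd number, and the row theorem applies
again. -/
theorem exists_short_of_not_isSeparated {r : ℕ} (hr : Module.finrank (ZMod 2) V = r)
    (hodd : Odd r) (hD : IsTameConfig c D)
    (hcard : (D.map Prod.fst).sum.card = D.card) (hDr : D.card = r + 1)
    (hsep : ¬ IsSeparated c D) :
    ∃ y, IsFact c (D.map Prod.snd).sum y ∧ 2 * y.card ≤ 2 + r * (r - 1) := by
  unfold IsSeparated at hsep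
  push Not at hsep
  obtain ⟨p, q, D', hdec, a, ha, b, hb, hab⟩ := hsep
  have hp : p ∈ D := by rw [hdec]; simp
  have hq : q ∈ D := by rw [hdec]; simp
  obtain ⟨a', ha'⟩ := hD.fst_eq_singleton hcard hp
  have haa : a = a' := by simpa [ha'] using ha
  subst haa
  obtain ⟨w, hw⟩ := Multiset.exists_cons_of_mem hb
  have hqfree := hD.free hq
  have hwcard : w.card + 1 ≤ r := by
    have := hqfree.card_le
    rw [hw, hr] at this
    simpa using this
  have hatom : IsMinZeroSum ((b ::ₘ p.2).map c) := by
    have := hD.atom p hp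
    rwa [ha', Multiset.singleton_add, Multiset.map_cons, hab, ← Multiset.map_cons] at this
  have hsplit : (D.map Prod.snd).sum = (b ::ₘ p.2) + (w ::ₘ D'.map Prod.snd).sum := by
    rw [hdec]
    simp only [Multiset.map_cons, Multiset.sum_cons, hw, Multiset.cons_add, Multiset.add_cons]
  have hsum := hD.sum_right
  rw [hsplit, Multiset.map_add, Multiset.sum_add, hatom.sum_eq, zero_add] at hsum
  have hD'card : D'.card + 1 = r := by
    rw [hdec] at hDr
    simpa using hDr
  have hfreeD' : ∀ x ∈ D'.map Prod.snd, ZeroSumFree (x.map c) := by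
    intro x hx
    obtain ⟨s, hs, rfl⟩ := Multiset.mem_map.1 hx
    exact hD.free (by rw [hdec]; simp [hs])
  obtain ⟨y, hy, hyc⟩ := exists_short_isFact_over (c := c) (rows := w ::ₘ D'.map Prod.snd)
    (by simpa [hD'card] using hodd) (by
      intro x hx
      rcases Multiset.mem_cons.1 hx with rfl | hx
      · exact hqfree.mono (Multiset.map_le_map (by rw [hw]; exact Multiset.le_cons_self _ _))
      · exact hfreeD' x hx) hsum
  have hpf : IsFact c (b ::ₘ p.2) {b ::ₘ p.2} :=
    ⟨by simp, fun x hx => by rwa [Multiset.mem_singleton.1 hx]⟩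
  refine ⟨_, by rw [hsplit]; exact hpf.add hy, ?_⟩
  have hW : (D'.map Prod.snd).sum.card ≤ r * D'.card := by
    have := Multiset.card_sum_le_mul_card (z := D'.map Prod.snd) (k := r) fun x hx => by
      simpa [hr] using (hfreeD' x hx).card_le
    simpa using this
  obtain ⟨k, hk⟩ := hodd
  have hD'k : D'.card = 2 * k := by omega
  simp only [Multiset.card_cons, Multiset.card_map, Multiset.sum_cons, Multiset.card_add, hr,
    Multiset.card_singleton] at hyc ⊢
  rw [hD'k] at hW hyc
  subst hk
  have h5 : 2 * k + 1 - 1 = 2 * k := by omega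
  rw [h5]
  -- The second alternative uses that the shortened row has at most `r - 1` terms; the final `+ 1`
  -- is removed by parity.
  have h6 : 2 * y.card ≤ 2 * ((2 * k + 1) * k) + 1 := by
    rcases hyc with h | h <;> nlinarith
  have h7 : (2 * k + 1) * (2 * k) = 2 * ((2 * k + 1) * k) := by ring
  omega

end IsTameConfig

/-- At most `r - 1` rows are handled by halving, `r` rows by the row theorem. With `r + 1` rows all
`uᵢ` are single primes, and the two preceding cases (separated or not) apply. -/
theorem tameBound_of_odd {r : ℕ} (hr : Module.finrank (ZMod 2) V = r) (h3 : 3 ≤ r)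
    (hodd : Odd r) {t : ℕ∞} (ht : TameBound (id : V → V) t) :
    TameBound c (max t ((2 + r * (r - 1) / 2 : ℕ) : ℕ∞)) := by
  refine tameBound_of_reduced fun D hD => ?_
  have hm := hD.card_le_card_left
  have hu := hD.left_card_le
  have hW := hD.card_left_add_card_right_le
  rw [hr] at hu hW
  obtain ⟨k, hk⟩ := id hodd
  have hdiv' : r * (r - 1) = 2 * ((2 * k + 1) * k) := by
    subst hk
    have : 2 * k + 1 - 1 = 2 * k := by omega
    rw [this]; ring
  have hdiv : r * (r - 1) / 2 = (2 * k + 1) * k := by omega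
  have hDN : D.card ≤ 2 + r * (r - 1) / 2 := by
    rw [hdiv]
    nlinarith
  have hmax : ∀ n : ℕ, 2 * n ≤ 2 + r * (r - 1) →
      ((n + 1 : ℕ) : ℕ∞) ≤ max t ((2 + r * (r - 1) / 2 : ℕ) : ℕ∞) := fun n hn =>
    le_max_of_le_right (Nat.cast_le.2 (by omega))
  have hDN' : (D.card : ℕ∞) ≤ max t ((2 + r * (r - 1) / 2 : ℕ) : ℕ∞) :=
    le_max_of_le_right (Nat.cast_le.2 hDN)
  rcases (show D.card + 1 ≤ r ∨ D.card = r ∨ D.card = r + 1 by omega) with hc | hc | hc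
  · obtain ⟨y, hy, hyc⟩ := hD.exists_isFact_right
    refine ⟨y, hy, hDN', hmax _ ?_⟩
    have : D.card ≤ r - 1 := by omega
    have := Nat.mul_le_mul_left r this
    nlinarith
  · obtain ⟨y, hy, hyc⟩ := hD.exists_short (by rwa [hc])
    refine ⟨y, hy, hDN', hmax _ ?_⟩
    rw [hr, hc] at hyc
    rw [hc] at hW hm
    rw [hdiv']
    subst hk
    rcases hyc with h | h <;> nlinarith
  · have hcard : (D.map Prod.fst).sum.card = D.card := by omega
    by_cases hsep : IsSeparated c D
    · obtain ⟨y, hy, hyc⟩ := hD.exists_short_of_isSeparated ht (by omega) hcard hsep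
      exact ⟨y, hy, hDN', le_max_of_le_left hyc⟩
    · obtain ⟨y, hy, hyc⟩ := hD.exists_short_of_not_isSeparated hr hodd hcard hc hsep
      exact ⟨y, hy, hDN', hmax _ hyc⟩

end OddRank

/-! ### The upper bound in rank three over the group itself. -/

section RankThree

variable {V : Type*} [AddCommGroup V] [Module (ZMod 2) V] [FiniteDimensional (ZMod 2) V]

omit [FiniteDimensional (ZMod 2) V] in
/-- In rank three, a linear form taking the value one on a basis takes it at just one other
vector. -/
theorem ZeroSumFree.exists_linearMap (hr : Module.finrank (ZMod 2) V = 3) {B : Multiset V}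
    (hB : ZeroSumFree B) (h3 : B.card = 3) :
    ∃ χ : V →ₗ[ZMod 2] ZMod 2, (∀ b ∈ B, χ b = 1) ∧ ∀ x, χ x = 1 → x ∈ B ∨ x = B.sum := by
  have hB' : ZeroSumFree (⟨B, hB.nodup⟩ : Finset V).val := hB
  have hli := hB'.linearIndepOn
  set S : Finset V := ⟨B, hB.nodup⟩ with hS
  have hcard : Fintype.card S = Module.finrank (ZMod 2) V := by
    rw [hr, Fintype.card_coe]
    exact h3
  have hli' : LinearIndependent (ZMod 2) (fun x : S => (x : V)) := hli
  have : Nonempty S := by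
    have : B ≠ 0 := by rintro rfl; simp at h3
    obtain ⟨a, ha⟩ := Multiset.exists_mem_of_ne_zero this
    exact ⟨⟨a, ha⟩⟩
  let b := basisOfLinearIndependentOfCardEqFinrank hli' hcard
  have hb : ∀ i : S, b i = (i : V) := fun i => by simp [b]
  let χ : V →ₗ[ZMod 2] ZMod 2 := b.constr (ZMod 2) fun _ => (1 : ZMod 2)
  have hχ : ∀ i : S, χ (i : V) = 1 := fun i => by
    rw [← hb i]
    exact b.constr_basis _ _ i
  refine ⟨χ, fun x hx => hχ ⟨x, hx⟩, fun x hx => ?_⟩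
  obtain ⟨u, v, w, huvw⟩ := Multiset.card_eq_three.1 h3
  have hu : χ u = 1 := hχ ⟨u, by simp [hS, huvw]⟩
  have hv : χ v = 1 := hχ ⟨v, by simp [hS, huvw]⟩
  have hw : χ w = 1 := hχ ⟨w, by simp [hS, huvw]⟩
  have hspan : x ∈ Submodule.span (ZMod 2) {u, v, w} := by
    have h1 : Set.range b = {u, v, w} := by
      ext y
      simp only [Set.mem_range, hb, Subtype.exists, exists_prop, exists_eq_right]
      simp [hS, huvw]
    rw [← h1, b.span_eq]
    trivial
  rw [Submodule.mem_span_insert] at hspan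
  obtain ⟨α, y, hy, rfl⟩ := hspan
  rw [Submodule.mem_span_pair] at hy
  obtain ⟨β, γ, rfl⟩ := hy
  rw [huvw]
  simp only [map_add, map_smul, hu, hv, hw, smul_eq_mul, mul_one] at hx
  have h2 : ∀ α β γ : ZMod 2, α + (β + γ) = 1 → (α = 1 ∧ β = 0 ∧ γ = 0) ∨
      (α = 0 ∧ β = 1 ∧ γ = 0) ∨ (α = 0 ∧ β = 0 ∧ γ = 1) ∨ (α = 1 ∧ β = 1 ∧ γ = 1) := by decide
  rcases h2 α β γ hx with ⟨rfl, rfl, rfl⟩ | ⟨rfl, rfl, rfl⟩ | ⟨rfl, rfl, rfl⟩ | ⟨rfl, rfl, rfl⟩ <;>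
    simp

/-- Let `χ` be one on the basis `w`, hence also on its sum. If that sum lies in `U`, one of the
other two members of `U` has `χ = 1`, so it lies in `w` or repeats `w.sum`; both are excluded. -/
theorem sum_notMem_of_card_three (hr : Module.finrank (ZMod 2) V = 3) {U w : Multiset V}
    (hU : IsMinZeroSum U) (hU3 : U.card = 3) (hw : ZeroSumFree w) (hw3 : w.card = 3)
    (hdis : ∀ x ∈ w, x ∉ U) : w.sum ∉ U := by
  intro hm
  obtain ⟨χ, h1, h2⟩ := hw.exists_linearMap hr hw3
  have hws : χ w.sum = 1 := by
    obtain ⟨u, v, x, rfl⟩ := Multiset.card_eq_three.1 hw3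
    simp only [Multiset.insert_eq_cons, Multiset.sum_cons, Multiset.sum_singleton, map_add]
    rw [h1 u (by simp), h1 v (by simp), h1 x (by simp)]
    decide
  obtain ⟨U', hU'⟩ := Multiset.exists_cons_of_mem hm
  have hnd := hU.nodup (by omega)
  rw [hU', Multiset.nodup_cons] at hnd
  have hsum := congrArg χ hU.sum_eq
  rw [hU', Multiset.sum_cons, map_add, map_zero, hws] at hsum
  rw [hU', Multiset.card_cons] at hU3
  obtain ⟨a, b, rfl⟩ := Multiset.card_eq_two.1 (by omega : U'.card = 2)
  simp only [Multiset.insert_eq_cons, Multiset.sum_cons, Multiset.sum_singleton, map_add] at hsum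
  have h3 : ∀ α β : ZMod 2, 1 + (α + β) = 0 → α = 1 ∨ β = 1 := by decide
  have h4 : ∀ x ∈ ({a, b} : Multiset V), χ x ≠ 1 := by
    intro x hx hx1
    rcases h2 x hx1 with h | h
    · exact hdis x h (by rw [hU']; exact Multiset.mem_cons_of_mem hx)
    · exact hnd.1 (h ▸ hx)
  rcases h3 _ _ hsum with h | h
  · exact h4 a (by simp) h
  · exact h4 b (by simp) h

/-- Here `U` is exactly an affine plane `χ = 1`, so a sequence avoiding it lies in the kernel of
`χ`, as does its sum. -/
theorem sum_notMem_of_card_four (hr : Module.finrank (ZMod 2) V = 3) {U w : Multiset V}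
    (hU : IsMinZeroSum U) (hU4 : U.card = 4) (hdis : ∀ x ∈ w, x ∉ U) : w.sum ∉ U := by
  intro hm
  obtain ⟨a, ha⟩ := Multiset.exists_mem_of_ne_zero hU.ne_zero
  obtain ⟨B, hB⟩ := Multiset.exists_cons_of_mem ha
  have hBc : B.card = 3 := by
    rw [hB] at hU4
    simpa using hU4
  have hBf := hU.zeroSumFree (hB ▸ Multiset.lt_cons_self B a)
  obtain ⟨χ, h1, h2⟩ := hBf.exists_linearMap hr hBc
  have haB : a = B.sum := by
    have := hU.sum_eq
    rw [hB, Multiset.sum_cons] at this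
    exact add_right_cancel (this.trans (ZModModule.add_self _).symm)
  have hχB : χ B.sum = 1 := by
    obtain ⟨u, v, x, rfl⟩ := Multiset.card_eq_three.1 hBc
    simp only [Multiset.insert_eq_cons, Multiset.sum_cons, Multiset.sum_singleton, map_add]
    rw [h1 u (by simp), h1 v (by simp), h1 x (by simp)]
    decide
  have hχU : ∀ x ∈ U, χ x = 1 := by
    intro x hx
    rw [hB, Multiset.mem_cons] at hx
    rcases hx with rfl | hx
    · rw [haB, hχB]
    · exact h1 x hx
  have hχw : ∀ x ∈ w, χ x = 0 := by
    intro x hx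
    have h01 : ∀ α : ZMod 2, α ≠ 1 → α = 0 := by decide
    refine h01 _ fun hx1 => hdis x hx ?_
    rw [hB, Multiset.mem_cons]
    rcases h2 x hx1 with h | h
    · exact Or.inr h
    · exact Or.inl (h.trans haB.symm)
  have h0 : χ w.sum = 0 := by
    rw [map_multiset_sum]
    refine Multiset.sum_eq_zero fun y hy => ?_
    obtain ⟨x, hx, rfl⟩ := Multiset.mem_map.1 hy
    exact hχw x hx
  rw [hχU _ hm] at h0
  exact absurd h0 (by decide)

variable {D : Multiset (Multiset V × Multiset V)}

-- When classes and primes coincide, a foreign row containing `uᵢ` would make the `i`-th factor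
-- superfluous.
omit [Module (ZMod 2) V] [FiniteDimensional (ZMod 2) V] in
theorem IsTameConfig.isSeparated (hD : IsTameConfig (id : V → V) D)
    (hcard : (D.map Prod.fst).sum.card = D.card) :
    IsSeparated (id : V → V) D := by
  intro p q D' hdec a ha b hb hab
  have hab' : a = b := hab
  subst hab'
  obtain ⟨a', ha'⟩ := hD.fst_eq_singleton hcard (p := p) (by rw [hdec]; simp)
  have haa : a = a' := by simpa [ha'] using ha
  subst haa
  refine hD.minimal p (q ::ₘ D') hdec ?_
  rw [hdec]
  simp only [Multiset.map_cons, Multiset.sum_cons, Multiset.sum_map_add, ha']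
  have : ({a} : Multiset V) ≤ q.2 := Multiset.singleton_le.2 hb
  calc ({a} : Multiset V) + (q.1 + (D'.map Prod.fst).sum)
      ≤ q.2 + (q.1 + (D'.map Prod.fst).sum) := add_le_add_left this _
    _ ≤ q.2 + (q.1 + (D'.map Prod.fst).sum) + (D'.map Prod.snd).sum := Multiset.le_add_right _ _
    _ = _ := by abel

/-- In a separated configuration over `V`, each `wᵢ` is disjoint from `u` or equals `uᵢ`. -/
theorem IsTameConfig.snd_eq_or_disjoint (hD : IsTameConfig (id : V → V) D)
    (hcard : (D.map Prod.fst).sum.card = D.card)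
    {p : Multiset V × Multiset V} (hp : p ∈ D) :
    p.2 = p.1 ∨ ((∀ x ∈ p.2, x ∉ (D.map Prod.fst).sum) ∧ p.2.sum ∈ (D.map Prod.fst).sum) := by
  have hsep := hD.isSeparated hcard
  obtain ⟨a, ha⟩ := hD.fst_eq_singleton hcard hp
  have hatom := hD.atom p hp
  rw [Multiset.map_id, ha] at hatom
  by_cases hap : a ∈ p.2
  · left
    have := hatom.eq_pair (x := a) (add_le_add_right (Multiset.singleton_le.2 hap) {a})
    have h2 : ({a, a} : Multiset V) = {a} + {a} := rfl
    rw [h2, add_right_inj] at this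
    rw [ha, this]
  · right
    constructor
    · intro x hx hxU
      obtain ⟨w, hw, hxw⟩ := Multiset.mem_sum_multiset.1 hxU
      obtain ⟨q, hq, rfl⟩ := Multiset.mem_map.1 hw
      by_cases hpq : q = p
      · subst hpq
        rw [ha, Multiset.mem_singleton] at hxw
        exact hap (hxw ▸ hx)
      · obtain ⟨D1, hD1⟩ := Multiset.exists_cons_of_mem hq
        have hpD1 : p ∈ D1 := by
          rw [hD1, Multiset.mem_cons] at hp
          exact hp.resolve_left fun h => hpq h.symm
        obtain ⟨D2, rfl⟩ := Multiset.exists_cons_of_mem hpD1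
        exact hsep q p D2 hD1 x hxw x hx rfl
    · have := hatom.sum_eq
      rw [Multiset.sum_add, Multiset.sum_singleton] at this
      have h2 : p.2.sum = a :=
        add_left_cancel (this.trans (ZModModule.add_self a).symm)
      rw [h2]
      exact Multiset.mem_sum_multiset.2 ⟨p.1, Multiset.mem_map_of_mem _ hp, by simp [ha]⟩

theorem tameBound_id_of_rank_three (hr : Module.finrank (ZMod 2) V = 3) :
    TameBound (id : V → V) 4 := by
  refine tameBound_of_reduced fun D hD => ?_
  have hm := hD.card_le_card_left
  have hu := hD.left_card_le
  have hW := hD.card_left_add_card_right_le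
  rw [hr] at hu hW
  have hDN : (D.card : ℕ∞) ≤ 4 := by exact_mod_cast hm.trans hu
  rcases (show D.card ≤ 2 ∨ D.card = 3 ∨ D.card = 4 by omega) with hc | hc | hc
  · obtain ⟨y, hy, hyc⟩ := hD.exists_isFact_right
    exact ⟨y, hy, hDN, by exact_mod_cast (by omega : y.card + 1 ≤ 4)⟩
  · by_cases h8 : (D.map Prod.snd).sum.card ≤ 8
    · obtain ⟨y, hy, hyc⟩ := hD.exists_short (by rw [hc]; decide)
      rw [hr, hc] at hyc
      exact ⟨y, hy, hDN, by exact_mod_cast (by omega : y.card + 1 ≤ 4)⟩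
    -- Now `|W| = 9`, so all three rows are bases and `|u| = 3`, which `sum_notMem_of_card_three`
    -- rules out.
    exfalso
    have hcard : (D.map Prod.fst).sum.card = D.card := by omega
    obtain ⟨p, hp⟩ := Multiset.exists_mem_of_ne_zero (s := D) (by rintro rfl; simp at hc)
    have hp3 : p.2.card = 3 := by
      obtain ⟨D', hD'⟩ := Multiset.exists_cons_of_mem hp
      have h1 := (hD.free hp).card_le
      have h2 := Multiset.card_sum_le_mul_card (z := D'.map Prod.snd) (k := 3) fun x hx => by
        obtain ⟨s, hs, rfl⟩ := Multiset.mem_map.1 hx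
        simpa [hr] using (hD.free (p := s) (by rw [hD']; simp [hs])).card_le
      rw [hr] at h1
      rw [hD'] at hc h8
      simp only [Multiset.card_map, Multiset.card_cons, Multiset.map_cons, Multiset.sum_cons,
        Multiset.card_add] at h1 h2 hc h8
      omega
    rcases hD.snd_eq_or_disjoint hcard hp with h | ⟨h, h'⟩
    · have := hD.left_card_eq_one hcard hp
      rw [← h] at this
      omega
    · exact sum_notMem_of_card_three hr (by simpa using hD.sum_left) (by omega)
        (by simpa using hD.free hp) hp3 h h'
  · have hcard : (D.map Prod.fst).sum.card = D.card := by omega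
    have hU : IsMinZeroSum (D.map Prod.fst).sum := by simpa using hD.sum_left
    -- With four rows every factor is forced to be the square of `uᵢ`, so `W = u` is a single atom.
    have hfst : D.map Prod.snd = D.map Prod.fst := Multiset.map_congr rfl fun p hp => by
      rcases hD.snd_eq_or_disjoint hcard hp with h | ⟨h, h'⟩
      · exact h
      · exact absurd h' (sum_notMem_of_card_four hr hU (by omega) h)
    refine ⟨{(D.map Prod.snd).sum}, ⟨by simp, fun a ha => ?_⟩, hDN, ?_⟩
    · rw [Multiset.mem_singleton.1 ha, hfst]
      exact hD.sum_left
    · simp only [Multiset.card_singleton]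
      exact_mod_cast (by omega : 1 + 1 ≤ 4)

end RankThree

/-! ### Tools for lower bounds. -/

section LowerBounds

variable {P V : Type*} [AddCommGroup V] {c : P → V} {N : ℕ∞}

/-- Factors of a sequence over a subset of the primes use only that subset, so tame bounds restrict
to it. -/
theorem TameBound.comp_injective {P' : Type*} {f : P' → P} (hf : Function.Injective f)
    (h : TameBound c N) : TameBound (c ∘ f) N := by
  intro u z hu hz huz
  obtain ⟨y, hy, huy, hd⟩ := h (u.map f) (z.map (Multiset.map f))
    (by rwa [Multiset.map_map]) (by
      intro v hv
      obtain ⟨w, hw, rfl⟩ := Multiset.mem_map.1 hv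
      rw [Multiset.map_map]
      exact hz w hw) (by rw [← Multiset.map_sum_multiset]; exact Multiset.map_le_map huz)
  rw [← Multiset.map_sum_multiset] at hy
  obtain ⟨y', hy', rfl⟩ := Multiset.exists_lift_sum hy.sum_eq.symm
  refine ⟨y', ⟨hy', fun a ha => ?_⟩, ?_, ?_⟩
  · rw [← Multiset.map_map]
    exact hy.atom _ (Multiset.mem_map_of_mem _ ha)
  · obtain ⟨a, ha, hau⟩ := Multiset.mem_map.1 huy
    rwa [← Multiset.map_injective hf hau]
  · rwa [multisetDist_map (Multiset.map_injective hf)] at hd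

/-- If no factor of `z` is `u` or divides `W`, where `z.sum = u + W`, then every factorization
containing `u` is disjoint from `z`. -/
theorem TameBound.exists_isFact (h : TameBound c N) {u W : Multiset P}
    {z : Multiset (Multiset P)} (hu : IsMinZeroSum (u.map c))
    (hz : ∀ v ∈ z, IsMinZeroSum (v.map c)) (hsum : z.sum = u + W)
    (hv : ∀ v ∈ z, v ≠ u ∧ ¬ v ≤ W) :
    ∃ y, IsFact c W y ∧ (z.card : ℕ∞) ≤ N ∧ ((y.card + 1 : ℕ) : ℕ∞) ≤ N := by
  obtain ⟨z', hz', huz', hd⟩ := h u z hu hz (by rw [hsum]; exact Multiset.le_add_right _ _)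
  obtain ⟨y, rfl⟩ := Multiset.exists_cons_of_mem huz'
  have hyW : y.sum = W := by
    have := hz'.sum_eq
    rwa [hsum, Multiset.sum_cons, add_right_inj] at this
  rw [multisetDist_eq_of_disjoint] at hd
  · refine ⟨y, ⟨hyW, fun a ha => hz'.atom a (by simp [ha])⟩, ?_, ?_⟩
    · exact (Nat.cast_le.2 (le_max_left _ _)).trans hd
    · rw [← Multiset.card_cons u y]
      exact (Nat.cast_le.2 (le_max_right _ _)).trans hd
  · intro v hvz hvy
    rcases Multiset.mem_cons.1 hvy with h | h
    · exact (hv v hvz).1 h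
    · exact (hv v hvz).2 (hyW ▸ Multiset.le_sum_of_mem_multiset h)

variable [Module (ZMod 2) V]

/-- A sequence over an independent set of classes factors only into atoms of length two. -/
theorem IsFact.two_mul_card_eq {E : Multiset V} (hE : ZeroSumFree E) {W : Multiset P}
    (hW : ∀ x ∈ W, c x ∈ E) {y : Multiset (Multiset P)} (hy : IsFact c W y) :
    2 * y.card = W.card := by
  have h2 : ∀ a ∈ y, a.card = 2 := by
    intro a ha
    have hat := hy.atom a ha
    by_contra hne
    have hnd := hat.nodup (by simpa using hne)
    have hle : a.map c ≤ E := (Multiset.le_iff_subset hnd).2 fun v hv => by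
      obtain ⟨x, hx, rfl⟩ := Multiset.mem_map.1 hv
      exact hW x (hy.sum_eq ▸ Multiset.mem_sum_multiset.2 ⟨a, ha, hx⟩)
    exact hat.ne_zero (hE _ hle hat.sum_eq)
  have h3 := Multiset.mul_card_le_card_sum (z := y) fun a ha => (h2 a ha).ge
  have h4 := Multiset.card_sum_le_mul_card (z := y) fun a ha => (h2 a ha).le
  rw [hy.sum_eq] at h3 h4
  omega

theorem Multiset.sum_map_pair {α : Type*} (s : Multiset α) :
    (s.map fun x => ({x, x} : Multiset α)).sum = s + s := by
  induction s using Multiset.induction_on with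
  | empty => simp
  | cons a s ih =>
    rw [Multiset.map_cons, Multiset.sum_cons, ih]
    simp only [Multiset.insert_eq_cons, ← Multiset.singleton_add]
    abel

/-- Witness: the product of the squares of the members of `U`, none of which can survive once `U` is
split off. -/
theorem TameBound.card_le_of_isMinZeroSum (h : TameBound (id : V → V) N) {U : Multiset V}
    (hU : IsMinZeroSum U) (h3 : 3 ≤ U.card) : (U.card : ℕ∞) ≤ N := by
  have h0 : (0 : V) ∉ U := fun h => by
    rw [hU.eq_singleton_zero h] at h3
    simp at h3
  obtain ⟨y, _, hN, _⟩ := h.exists_isFact (u := U) (W := U) (z := U.map fun x => {x, x})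
    (by simpa using hU) (by
      intro v hv
      obtain ⟨x, hx, rfl⟩ := Multiset.mem_map.1 hv
      rw [Multiset.map_id]
      exact isMinZeroSum_pair fun hx0 => h0 (hx0 ▸ hx)) (Multiset.sum_map_pair U) (by
      intro v hv
      obtain ⟨x, hx, rfl⟩ := Multiset.mem_map.1 hv
      have : ¬ ({x, x} : Multiset V) ≤ U := fun hle => by
        rw [hU.eq_pair hle] at h3
        simp at h3
      exact ⟨fun h => this h.le, this⟩)
  simpa using hN

/-- Witness: `p² · q² = (pq)(pq)`. -/
theorem TameBound.two_le_of_ne (h : TameBound c N) {p q : P} (hpq : p ≠ q) (hc : c p = c q)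
    (h0 : c p ≠ 0) : 2 ≤ N := by
  obtain ⟨y, _, hN, _⟩ := h.exists_isFact (u := {p, q}) (W := {p, q}) (z := {{p, p}, {q, q}})
    (by simpa [← hc] using isMinZeroSum_pair h0) (by
      intro v hv
      simp only [Multiset.insert_eq_cons, Multiset.mem_cons, Multiset.mem_singleton] at hv
      rcases hv with rfl | rfl
      · simpa using isMinZeroSum_pair h0
      · simpa [← hc] using isMinZeroSum_pair h0) (by
      simp only [Multiset.insert_eq_cons, Multiset.sum_cons, Multiset.sum_singleton]
      simp only [← Multiset.singleton_add]
      abel) (by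
      have h2 : ∀ x, ¬ ({x, x} : Multiset P) ≤ {p, q} := fun x hx => by
        have := Multiset.eq_of_le_of_card_le hx (by simp)
        have hp : p ∈ ({x, x} : Multiset P) := by rw [this]; simp
        have hq : q ∈ ({x, x} : Multiset P) := by rw [this]; simp
        simp at hp hq
        exact hpq (hp.trans hq.symm)
      intro v hv
      simp only [Multiset.insert_eq_cons, Multiset.mem_cons, Multiset.mem_singleton] at hv
      rcases hv with rfl | rfl
      · exact ⟨fun h => h2 p h.le, h2 p⟩
      · exact ⟨fun h => h2 q h.le, h2 q⟩)
  simpa using hN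

end LowerBounds

/-! ### Rank one. -/

section RankOne

variable {P V : Type*} [AddCommGroup V] [Module (ZMod 2) V] [FiniteDimensional (ZMod 2) V]
  {c : P → V}

theorem tameBound_of_rank_one (hr : Module.finrank (ZMod 2) V = 1) : TameBound c 2 := by
  refine tameBound_of_reduced fun D hD => ?_
  have hm := hD.card_le_card_left
  have hu := hD.left_card_le
  have hW := hD.card_left_add_card_right_le
  rw [hr] at hu hW
  obtain ⟨y, hy, hyc⟩ := hD.exists_isFact_right
  exact ⟨y, hy, by exact_mod_cast (by omega : D.card ≤ 2),
    by exact_mod_cast (by omega : y.card + 1 ≤ 2)⟩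

theorem IsMinZeroSum.eq_of_mem_of_rank_one (hr : Module.finrank (ZMod 2) V = 1)
    {s : Multiset V} (hs : IsMinZeroSum s) {x : V} (hx : x ∈ s) (hx0 : x ≠ 0) : s = {x, x} := by
  have h0 : (0 : V) ∉ s := fun h => by
    rw [hs.eq_singleton_zero h, Multiset.mem_singleton] at hx
    exact hx0 hx
  have h1 := hs.card_le
  have h2 := hs.two_le_card h0
  obtain ⟨y, rfl⟩ := hs.exists_eq_pair (by omega)
  simp at hx
  rw [hx]

/-- Over a group of order two any letter determines the atom containing it, so an atom dividing a
product is already one of its factors. -/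
theorem tameBound_id_of_rank_one (hr : Module.finrank (ZMod 2) V = 1) :
    TameBound (id : V → V) 0 := by
  intro u z hu hz huz
  refine ⟨z, ⟨rfl, hz⟩, ?_, by rw [multisetDist_self]; simp⟩
  rw [Multiset.map_id] at hu
  obtain ⟨x, hx⟩ := Multiset.exists_mem_of_ne_zero hu.ne_zero
  obtain ⟨v, hv, hxv⟩ := Multiset.mem_sum_multiset.1 (Multiset.mem_of_le huz hx)
  have hvm := hz v hv
  rw [Multiset.map_id] at hvm
  have : u = v := by
    by_cases hx0 : x = 0
    · subst hx0
      rw [hu.eq_singleton_zero hx, hvm.eq_singleton_zero hxv]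
    · rw [hu.eq_of_mem_of_rank_one hr hx hx0, hvm.eq_of_mem_of_rank_one hr hxv hx0]
  rwa [this]

omit [FiniteDimensional (ZMod 2) V] in
theorem pair_le_of_sum_eq_zero {p : P} (hp : c p ≠ 0) (huniq : ∀ q, c q ≠ 0 → q = p)
    {S : Multiset P} (hS : (S.map c).sum = 0) (hpS : p ∈ S) : {p, p} ≤ S := by
  classical
  have h : ∀ T : Multiset P, (T.map c).sum = T.count p • c p := by
    intro T
    induction T using Multiset.induction_on with
    | empty => simp
    | cons q T ih =>
      rw [Multiset.map_cons, Multiset.sum_cons, ih]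
      by_cases hq : q = p
      · subst hq
        rw [Multiset.count_cons_self, succ_nsmul, add_comm]
      · rw [Multiset.count_cons_of_ne (Ne.symm hq)]
        have : c q = 0 := by
          by_contra h
          exact hq (huniq q h)
        rw [this, zero_add]
  have heven := even_of_nsmul_eq_zero hp ((h S).symm.trans hS)
  have hpos := Multiset.count_pos.2 hpS
  have : ({p, p} : Multiset P) = Multiset.replicate 2 p := rfl
  rw [this, ← Multiset.le_count_iff_replicate_le]
  obtain ⟨k, hk⟩ := heven
  omega

end RankOne

/-! ### A configuration of tame degree five in rank three. -/

section RankThreeLower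

variable {P V : Type*} [AddCommGroup V] [Module (ZMod 2) V] [FiniteDimensional (ZMod 2) V]
  {c : P → V} {N : ℕ∞}

theorem exists_basis_of_rank_three (hr : Module.finrank (ZMod 2) V = 3) {g : V} :
    ∃ e f : V, e ≠ 0 ∧ e ≠ g ∧ f ≠ 0 ∧ f ≠ g ∧ f ≠ e ∧ f ≠ g + e := by
  classical
  have : Finite V := Module.finite_of_finite (ZMod 2)
  cases nonempty_fintype V
  have hcard : Fintype.card V = 8 := by
    have := Module.card_eq_pow_finrank (K := ZMod 2) (V := V)
    rw [this, hr]
    rfl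
  have hex : ∀ s : Finset V, s.card ≤ 7 → ∃ x, x ∉ s := by
    intro s hs
    by_contra! h
    have := Finset.card_le_card (fun x _ => h x : (Finset.univ : Finset V) ⊆ s)
    rw [Finset.card_univ, hcard] at this
    omega
  obtain ⟨e, he⟩ := hex {0, g} (Finset.card_le_two.trans (by norm_num))
  obtain ⟨f, hf⟩ := hex {0, g, e, g + e} (Finset.card_le_four.trans (by norm_num))
  simp only [Finset.mem_insert, Finset.mem_singleton, not_or] at he hf
  exact ⟨e, f, he.1, he.2, hf.1, hf.2.1, hf.2.2.1, hf.2.2.2⟩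

omit [FiniteDimensional (ZMod 2) V] in
theorem add_eq_zero_iff_eq_of_charTwo {a b : V} : a + b = 0 ↔ a = b :=
  ⟨fun hab => add_right_cancel (hab.trans (ZModModule.add_self b).symm),
    fun hab => hab ▸ ZModModule.add_self a⟩

omit [FiniteDimensional (ZMod 2) V] in
theorem zeroSumFree_triple {a b d : V} (ha : a ≠ 0) (hb : b ≠ 0) (hd : d ≠ 0) (hab : a ≠ b)
    (had : a ≠ d) (hbd : b ≠ d) (habd : a + b ≠ d) : ZeroSumFree ({a, b, d} : Multiset V) := by
  intro t ht h0
  rw [← Multiset.mem_powerset] at ht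
  have h1 : Multiset.powerset ({a, b, d} : Multiset V) =
      {0, {d}, {b}, {b, d}, {a}, {a, d}, {a, b}, {a, b, d}} := by
    rw [Multiset.insert_eq_cons, Multiset.insert_eq_cons, ← Multiset.cons_zero d,
      Multiset.powerset_cons, Multiset.powerset_cons, Multiset.powerset_cons,
      Multiset.powerset_zero]
    rfl
  rw [h1] at ht
  simp only [Multiset.insert_eq_cons, Multiset.mem_cons, Multiset.mem_singleton] at ht
  rcases ht with rfl | rfl | rfl | rfl | rfl | rfl | rfl | rfl
  · rfl
  all_goals
    simp only [Multiset.sum_cons, Multiset.sum_singleton, ← add_assoc] at h0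
    first
    | exact absurd h0 ‹_›
    | exact absurd (add_eq_zero_iff_eq_of_charTwo.1 h0) ‹_›

/-- Take classes `g, e, f` forming a basis, `u = p x y w` with `x, y, w` in the classes `g + e + f`,
`g + e`, `g + f`, and the product `(x q pe pf)(y q pe)(w q pf)(p p)`. Removing `u` leaves eight
primes in basis classes, hence exactly four atoms of length 2. The prime `p` remains only once, so
`p²` cannot survive; this is where `p ≠ q` is essential. -/
theorem TameBound.five_le (h : TameBound c N) (hr : Module.finrank (ZMod 2) V = 3)
    (hc : Function.Surjective c) {p q : P} (hpq : p ≠ q) {g : V} (hp : c p = g) (hq : c q = g)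
    (h0 : g ≠ 0) : 5 ≤ N := by
  obtain ⟨e, f, he0, heg, hf0, hfg, hfe, hfge⟩ := exists_basis_of_rank_three hr (g := g)
  obtain ⟨pe, hpe⟩ := hc e
  obtain ⟨pf, hpf⟩ := hc f
  obtain ⟨x, hx⟩ := hc (g + e + f)
  obtain ⟨y, hy⟩ := hc (g + e)
  obtain ⟨w, hw⟩ := hc (g + f)
  have hge : g + e ≠ 0 := fun h => heg (add_eq_zero_iff_eq_of_charTwo.1 h).symm
  have hgf : g + f ≠ 0 := fun h => hfg (add_eq_zero_iff_eq_of_charTwo.1 h).symm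
  have hgef : g + e + f ≠ 0 := fun h => hfge (add_eq_zero_iff_eq_of_charTwo.1 h).symm
  have hef : e + f ≠ 0 := fun h => hfe (add_eq_zero_iff_eq_of_charTwo.1 h).symm
  have hE : ZeroSumFree ({g, e, f} : Multiset V) :=
    zeroSumFree_triple h0 he0 hf0 heg.symm hfg.symm hfe.symm hfge.symm
  have hsum : (g + e + f) + (g + e) + (g + f) = g := by
    have : (g + e + f) + (g + e) + (g + f) = g + ((g + g) + (e + e) + (f + f)) := by abel
    rw [this, ZModModule.add_self, ZModModule.add_self, ZModModule.add_self f]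
    simp
  have hB : ZeroSumFree ({g + e + f, g + e, g + f} : Multiset V) := by
    refine zeroSumFree_triple hgef hge hgf (by simpa using hf0) ?_ ?_ ?_
    · intro h
      rw [add_right_comm] at h
      exact he0 (by simpa using h)
    · intro h
      exact hfe (add_left_cancel h).symm
    · intro h
      rw [← add_eq_zero_iff_eq_of_charTwo, hsum] at h
      exact h0 h
  have hsub : ∀ v : V, v = e ∨ v = f → ZeroSumFree ({g, v} : Multiset V) := by
    rintro v (rfl | rfl)
    · exact hE.mono (by
        simp only [Multiset.insert_eq_cons, ← Multiset.singleton_add]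
        exact add_le_add_right (Multiset.le_add_right _ _) _)
    · exact hE.mono (by
        simp only [Multiset.insert_eq_cons, ← Multiset.singleton_add]
        exact add_le_add_right (Multiset.le_add_left _ _) _)
  have hne : ∀ {a b : P} {v w : V}, c a = v → c b = w → v ≠ w → a ≠ b := by
    rintro a b v w rfl rfl h rfl
    exact h rfl
  have hpx : p ≠ x := hne hp hx fun h => hef (by rw [add_assoc] at h; simpa using h.symm)
  have hpy : p ≠ y := hne hp hy fun h => he0 (by simpa using h.symm)
  have hpw : p ≠ w := hne hp hw fun h => hf0 (by simpa using h.symm)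
  have hppe : p ≠ pe := hne hp hpe heg.symm
  have hppf : p ≠ pf := hne hp hpf hfg.symm
  have hcW : ∀ v ∈ ({q, q, q, p, pe, pe, pf, pf} : Multiset P), c v ∈ ({g, e, f} : Multiset V) := by
    intro v hv
    simp only [Multiset.insert_eq_cons, Multiset.mem_cons, Multiset.mem_singleton] at hv ⊢
    rcases hv with rfl | rfl | rfl | rfl | rfl | rfl | rfl | rfl <;> simp [*]
  have hgefE : g + e + f ∉ ({g, e, f} : Multiset V) := by
    simp only [Multiset.insert_eq_cons, Multiset.mem_cons, Multiset.mem_singleton, not_or]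
    refine ⟨fun h => hef (by rw [add_assoc] at h; simpa using h), fun h => hgf ?_, fun h => hge ?_⟩
    · rw [add_right_comm] at h; simpa using h
    · simpa using h
  have hgeE : g + e ∉ ({g, e, f} : Multiset V) := by
    simp only [Multiset.insert_eq_cons, Multiset.mem_cons, Multiset.mem_singleton, not_or]
    exact ⟨fun h => he0 (by simpa using h), fun h => h0 (by simpa using h), fun h => hfge h.symm⟩
  have hgfE : g + f ∉ ({g, e, f} : Multiset V) := by
    simp only [Multiset.insert_eq_cons, Multiset.mem_cons, Multiset.mem_singleton, not_or]
    refine ⟨fun h => hf0 (by simpa using h), fun h => hfge ?_, fun h => h0 (by simpa using h)⟩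
    rw [← h, ← add_assoc, ZModModule.add_self, zero_add]
  obtain ⟨Y, hY, _, hN⟩ := h.exists_isFact (u := {p, x, y, w}) (W := {q, q, q, p, pe, pe, pf, pf})
    (z := {{x, q, pe, pf}, {y, q, pe}, {w, q, pf}, {p, p}})
    (by
      have := hB.isMinZeroSum_cons (e := g) (by simpa [add_assoc] using hsum)
      simpa [hp, hx, hy, hw] using this)
    (by
      intro v hv
      simp only [Multiset.insert_eq_cons, Multiset.mem_cons, Multiset.mem_singleton] at hv
      rcases hv with rfl | rfl | rfl | rfl
      · have := hE.isMinZeroSum_cons (e := g + e + f) (by simp [add_assoc])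
        simpa [hx, hq, hpe, hpf] using this
      · have := (hsub e (Or.inl rfl)).isMinZeroSum_cons (e := g + e) (by simp)
        simpa [hy, hq, hpe] using this
      · have := (hsub f (Or.inr rfl)).isMinZeroSum_cons (e := g + f) (by simp)
        simpa [hw, hq, hpf] using this
      · simpa [hp] using isMinZeroSum_pair h0) (by
      simp only [Multiset.insert_eq_cons, Multiset.sum_cons, Multiset.sum_singleton]
      simp only [← Multiset.singleton_add]
      abel) (by
      have key : ∀ (s : Multiset P) (a : P), a ∈ s → c a ∉ ({g, e, f} : Multiset V) →
          ¬ s ≤ {q, q, q, p, pe, pe, pf, pf} := fun s a ha hca hle =>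
        hca (hcW a (Multiset.mem_of_le hle ha))
      have key2 : ∀ s : Multiset P, p ∉ s → s ≠ {p, x, y, w} := by
        rintro s hs rfl
        simp at hs
      intro v hv
      simp only [Multiset.insert_eq_cons, Multiset.mem_cons, Multiset.mem_singleton] at hv
      rcases hv with rfl | rfl | rfl | rfl
      · exact ⟨key2 _ (by simp [*]), key _ x (by simp) (hx ▸ hgefE)⟩
      · exact ⟨key2 _ (by simp [*]), key _ y (by simp) (hy ▸ hgeE)⟩
      · exact ⟨key2 _ (by simp [*]), key _ w (by simp) (hw ▸ hgfE)⟩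
      · refine ⟨fun h => ?_, fun hle => ?_⟩
        · have := congrArg Multiset.card h
          simp at this
        · classical
          have := Multiset.count_le_of_le p hle
          simp [*] at this)
  have h8 := hY.two_mul_card_eq hE hcW
  simp only [Multiset.insert_eq_cons, Multiset.card_cons, Multiset.card_singleton] at h8
  have h4 : Y.card = 4 := by omega
  rw [h4] at hN
  exact_mod_cast hN

end RankThreeLower

/-! ### Explicit lower bound constructions in coordinates. -/

section Coordinates

variable {ι : Type*} [Fintype ι] [DecidableEq ι]

/-- The standard basis of `𝔽₂^ι`, as a sequence. -/
def stdBasisSeq (ι : Type*) [Fintype ι] [DecidableEq ι] : Multiset (ι → ZMod 2) :=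
  Finset.univ.val.map fun i => Pi.single i 1

/-- The weight of a vector over `𝔽₂`. -/
def hammingWt (x : ι → ZMod 2) : ℕ := (Finset.univ.filter fun i => x i = 1).card

/-- The standard basis vectors that sum to `x`. -/
def suppSeq (x : ι → ZMod 2) : Multiset (ι → ZMod 2) :=
  (Finset.univ.filter fun i => x i = 1).val.map fun i => Pi.single i 1

theorem suppSeq_le (x : ι → ZMod 2) : suppSeq x ≤ stdBasisSeq ι :=
  Multiset.map_le_map (Finset.val_le_iff.2 (Finset.filter_subset _ _))

theorem card_suppSeq (x : ι → ZMod 2) : (suppSeq x).card = hammingWt x :=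
  Multiset.card_map _ _

omit [Fintype ι] in
theorem sum_single_apply (s : Finset ι) (j : ι) :
    (s.val.map fun i => (Pi.single i 1 : ι → ZMod 2)).sum j = if j ∈ s then 1 else 0 := by
  change (∑ i ∈ s, (Pi.single i 1 : ι → ZMod 2)) j = _
  rw [Finset.sum_apply]
  simp [Pi.single_apply]

theorem sum_suppSeq (x : ι → ZMod 2) : (suppSeq x).sum = x := by
  funext j
  rw [suppSeq, sum_single_apply]
  have : ∀ a : ZMod 2, (if a = 1 then 1 else 0) = a := by decide
  simpa using this (x j)

omit [DecidableEq ι] in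
/-- A sequence indexed by a finite type is zero-sum free if no nonempty subset of the index set
sums to zero. -/
theorem zeroSumFree_map_univ {V : Type*} [AddCommGroup V] {g : ι → V}
    (h : ∀ s : Finset ι, ∑ i ∈ s, g i = 0 → s = ∅) : ZeroSumFree (Finset.univ.val.map g) := by
  intro t ht h0
  obtain ⟨S, hS, rfl⟩ := Multiset.exists_map_eq_of_le ht
  have := h ⟨S, Multiset.nodup_of_le hS Finset.univ.nodup⟩ h0
  have h2 := congrArg Finset.val this
  simp only [Finset.empty_val] at h2
  rw [h2, Multiset.map_zero]

theorem zeroSumFree_stdBasisSeq : ZeroSumFree (stdBasisSeq ι) := by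
  refine zeroSumFree_map_univ fun s hs => ?_
  by_contra hne
  obtain ⟨j, hj⟩ := Finset.nonempty_iff_ne_empty.2 hne
  have h1 := sum_single_apply s j
  change (∑ i ∈ s, (Pi.single i 1 : ι → ZMod 2)) j = _ at h1
  rw [hs, if_pos hj] at h1
  simp at h1

theorem hammingWt_eq_one_of_mem {x : ι → ZMod 2} (hx : x ∈ stdBasisSeq ι) : hammingWt x = 1 := by
  obtain ⟨i, _, rfl⟩ := Multiset.mem_map.1 hx
  have : (Finset.univ.filter fun j => (Pi.single i 1 : ι → ZMod 2) j = 1) = {i} := by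
    ext j
    by_cases h : j = i <;> simp [Pi.single_apply, h]
  rw [hammingWt, this, Finset.card_singleton]

/-- A minimal zero-sum sequence of vectors of weight at least two bounds the tame degree from
below by half of its total weight. -/
theorem TameBound.exists_hammingWt_le {N : ℕ∞} (h : TameBound (id : (ι → ZMod 2) → _) N)
    {U : Multiset (ι → ZMod 2)} (hU : IsMinZeroSum U) (h2 : ∀ x ∈ U, 2 ≤ hammingWt x) :
    ∃ L : ℕ, 2 * L = (U.map hammingWt).sum ∧ ((L + 1 : ℕ) : ℕ∞) ≤ N := by
  have hE := zeroSumFree_stdBasisSeq (ι := ι)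
  have hW : ∀ x ∈ (U.map suppSeq).sum, x ∈ stdBasisSeq ι := by
    intro x hx
    obtain ⟨w, hw, hxw⟩ := Multiset.mem_sum_multiset.1 hx
    obtain ⟨g, _, rfl⟩ := Multiset.mem_map.1 hw
    exact Multiset.mem_of_le (suppSeq_le g) hxw
  have hsum : ∀ Y : Multiset (ι → ZMod 2),
      (Y.map fun x => x ::ₘ suppSeq x).sum = Y + (Y.map suppSeq).sum := by
    intro Y
    induction Y using Multiset.induction_on with
    | empty => simp
    | cons a Y ih =>
      rw [Multiset.map_cons, Multiset.sum_cons, ih, Multiset.map_cons, Multiset.sum_cons,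
        ← Multiset.singleton_add, ← Multiset.singleton_add]
      abel
  -- Each `x` in `U` is completed to a circuit by its support. Weight at least 2 keeps `x` out of
  -- the basis, so no circuit divides `W`, and no circuit equals `U`.
  obtain ⟨y, hy, _, hN⟩ := h.exists_isFact (u := U) (z := U.map fun x => x ::ₘ suppSeq x)
    (W := (U.map suppSeq).sum) (by simpa using hU) (by
      intro v hv
      obtain ⟨x, hx, rfl⟩ := Multiset.mem_map.1 hv
      rw [Multiset.map_id]
      exact (hE.mono (suppSeq_le x)).isMinZeroSum_cons (sum_suppSeq x)) (hsum U) (by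
      intro v hv
      obtain ⟨x, hx, rfl⟩ := Multiset.mem_map.1 hv
      refine ⟨fun hEq => ?_, fun hle => ?_⟩
      · have hc := card_suppSeq x
        have h0 : suppSeq x ≠ 0 := fun h0 => by
          rw [h0] at hc
          have := h2 x hx
          simp at hc
          omega
        obtain ⟨b, hb⟩ := Multiset.exists_mem_of_ne_zero h0
        have h1 := hammingWt_eq_one_of_mem (Multiset.mem_of_le (suppSeq_le x) hb)
        have h3 := h2 b (hEq ▸ Multiset.mem_cons_of_mem hb)
        omega
      · have h1 := hammingWt_eq_one_of_mem
          (hW x (Multiset.mem_of_le hle (Multiset.mem_cons_self _ _)))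
        have h3 := h2 x hx
        omega)
  refine ⟨y.card, ?_, hN⟩
  rw [hy.two_mul_card_eq hE hW]
  have : ∀ Y : Multiset (ι → ZMod 2), (Y.map suppSeq).sum.card = (Y.map hammingWt).sum := by
    intro Y
    induction Y using Multiset.induction_on with
    | empty => simp
    | cons a Y ih => simp [ih, card_suppSeq]
  exact this U

theorem TameBound.card_add_one_le {N : ℕ∞} (h : TameBound (id : (ι → ZMod 2) → _) N)
    (h2 : 2 ≤ Fintype.card ι) : ((Fintype.card ι + 1 : ℕ) : ℕ∞) ≤ N := by
  have := h.card_le_of_isMinZeroSum ((zeroSumFree_stdBasisSeq (ι := ι)).isMinZeroSum_cons rfl)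
    (by simp [stdBasisSeq]; omega)
  simpa [stdBasisSeq] using this

omit [DecidableEq ι] in
theorem hammingWt_one : hammingWt (1 : ι → ZMod 2) = Fintype.card ι := by
  simp [hammingWt]

/-- The witness consists of the all-ones vector and the `r` vectors `1 + eᵢ` of weight `r - 1`, of
total weight `r²`. For `r = 2` the latter have weight one, hence `4 ≤ r`. -/
theorem TameBound.le_of_even {r : ℕ} {N : ℕ∞} (h : TameBound (id : (Fin r → ZMod 2) → _) N)
    (h4 : 4 ≤ r) (heven : Even r) : ((1 + r ^ 2 / 2 : ℕ) : ℕ∞) ≤ N := by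
  let g : Fin r → Fin r → ZMod 2 := fun i => 1 + Pi.single i 1
  have hgsum : ∀ (s : Finset (Fin r)) (j : Fin r),
      (∑ i ∈ s, g i) j = (s.card : ZMod 2) + if j ∈ s then 1 else 0 := by
    intro s j
    rw [Finset.sum_apply]
    simp [g, Finset.sum_add_distrib, Pi.single_apply]
  have hr0 : (r : ZMod 2) = 0 := (ZMod.natCast_eq_zero_iff_even).2 heven
  have hfree : ZeroSumFree (Finset.univ.val.map g) := by
    refine zeroSumFree_map_univ fun s hs => ?_
    by_contra hne
    obtain ⟨j, hj⟩ := Finset.nonempty_iff_ne_empty.2 hne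
    have h1 := hgsum s j
    rw [hs, if_pos hj] at h1
    -- A coordinate inside `s` forces `|s|` odd and one outside forces `|s|` even, so `s` would be
    -- everything, of even size `r`.
    have h2 : (s.card : ZMod 2) = 1 := by
      have : ∀ a : ZMod 2, 0 = a + 1 → a = 1 := by decide
      exact this _ h1
    have h3 : s = Finset.univ := by
      rw [Finset.eq_univ_iff_forall]
      intro i
      by_contra hi
      have h4 := hgsum s i
      rw [hs, if_neg hi, h2] at h4
      simp at h4
    rw [h3, Finset.card_univ, Fintype.card_fin, hr0] at h2
    exact absurd h2 (by decide)
  have hsum : (Finset.univ.val.map g).sum = 1 := by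
    funext j
    have := hgsum Finset.univ j
    rw [if_pos (Finset.mem_univ j), Finset.card_univ, Fintype.card_fin, hr0, zero_add] at this
    exact this
  have hwt : ∀ i, hammingWt (g i) = r - 1 := by
    intro i
    have : (Finset.univ.filter fun j => g i j = 1) = Finset.univ.erase i := by
      ext j
      by_cases hj : j = i <;> simp [g, Pi.single_apply, hj]
    rw [hammingWt, this, Finset.card_erase_of_mem (Finset.mem_univ i), Finset.card_univ,
      Fintype.card_fin]
  obtain ⟨L, hL, hN⟩ := h.exists_hammingWt_le (hfree.isMinZeroSum_cons hsum) (by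
    intro x hx
    rcases Multiset.mem_cons.1 hx with rfl | hx
    · rw [hammingWt_one, Fintype.card_fin]; omega
    · obtain ⟨i, _, rfl⟩ := Multiset.mem_map.1 hx
      rw [hwt]; omega)
  rw [Multiset.map_cons, Multiset.sum_cons, hammingWt_one, Fintype.card_fin, Multiset.map_map] at hL
  have h5 : (Finset.univ.val.map (hammingWt ∘ g)).sum = r * (r - 1) := by
    change ∑ i : Fin r, hammingWt (g i) = _
    simp [hwt]
  rw [h5] at hL
  refine le_trans (Nat.cast_le.2 ?_) hN
  obtain ⟨k, rfl⟩ := Nat.exists_eq_add_of_le' (show 1 ≤ r by omega)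
  have h6 : k + 1 + (k + 1) * (k + 1 - 1) = (k + 1) ^ 2 := by
    rw [Nat.add_sub_cancel]; ring
  omega

/-- For odd `r = n + 1`, the incidence pattern of a path replaces the identity matrix: coordinate
`0` is always 1, and coordinate `j + 1` vanishes exactly on the vectors `j` and `j + 1`. Together
with the all-ones vector the total weight is at least `2r + (r - 1)(r - 2) = r(r - 1) + 2`. -/
theorem TameBound.le_of_odd {r : ℕ} {N : ℕ∞} (h : TameBound (id : (Fin r → ZMod 2) → _) N)
    (h5 : 5 ≤ r) (hodd : Odd r) : ((2 + r * (r - 1) / 2 : ℕ) : ℕ∞) ≤ N := by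
  obtain ⟨n, rfl⟩ := Nat.exists_eq_add_of_le' (show 1 ≤ r by omega)
  let g : Fin (n + 1) → Fin (n + 1) → ZMod 2 := fun i =>
    Fin.cons 1 fun j : Fin n =>
      1 + ((if i = j.succ then 1 else 0) + if i = j.castSucc then 1 else 0)
  have hgsum0 : ∀ s : Finset (Fin (n + 1)), (∑ i ∈ s, g i) 0 = (s.card : ZMod 2) := by
    intro s
    rw [Finset.sum_apply]
    simp [g]
  have hgsum : ∀ (s : Finset (Fin (n + 1))) (j : Fin n),
      (∑ i ∈ s, g i) j.succ = (s.card : ZMod 2) +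
        ((if j.succ ∈ s then 1 else 0) + if j.castSucc ∈ s then 1 else 0) := by
    intro s j
    rw [Finset.sum_apply]
    simp [g, Finset.sum_add_distrib]
  have hr1 : ((n + 1 : ℕ) : ZMod 2) = 1 := (ZMod.natCast_eq_one_iff_odd).2 hodd
  have hfree : ZeroSumFree (Finset.univ.val.map g) := by
    refine zeroSumFree_map_univ fun s hs => ?_
    have h0 : (s.card : ZMod 2) = 0 := by rw [← hgsum0, hs]; rfl
    -- Coordinate `0` makes `|s|` even; then the coordinates along the path propagate membership
    -- from each vertex to the next, so `s` is empty or everything.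
    have hstep : ∀ j : Fin n, j.succ ∈ s ↔ j.castSucc ∈ s := by
      intro j
      have h1 := hgsum s j
      rw [hs, h0, zero_add] at h1
      by_cases ha : j.succ ∈ s <;> by_cases hb : j.castSucc ∈ s <;> simp [ha, hb] at h1 ⊢
    have hall : ∀ j : Fin (n + 1), j ∈ s ↔ (0 : Fin (n + 1)) ∈ s := by
      intro j
      induction j using Fin.induction with
      | zero => rfl
      | succ j ih => rw [hstep, ih]
    by_cases hm : (0 : Fin (n + 1)) ∈ s
    · have h3 : s = Finset.univ := Finset.eq_univ_iff_forall.2 fun j => (hall j).2 hm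
      rw [h3, Finset.card_univ, Fintype.card_fin, hr1] at h0
      exact absurd h0 (by decide)
    · exact Finset.eq_empty_iff_forall_notMem.2 fun j hj => hm ((hall j).1 hj)
  have hsum : (Finset.univ.val.map g).sum = 1 := by
    funext j
    change (∑ i, g i) j = 1
    induction j using Fin.cases with
    | zero => rw [hgsum0, Finset.card_univ, Fintype.card_fin, hr1]
    | succ j =>
      rw [hgsum, Finset.card_univ, Fintype.card_fin, hr1]
      simp only [Finset.mem_univ, if_true]
      decide
  have hwt2 : ∀ i, 2 ≤ hammingWt (g i) := by
    intro i
    have h1 : (Finset.univ.filter fun j => ¬ g i j = 1).card ≤ ({i.val, i.val + 1} : Finset ℕ).card := by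
      refine Finset.card_le_card_of_injOn Fin.val (fun j hj => ?_) Fin.val_injective.injOn
      simp only [Finset.coe_filter, Finset.mem_univ, true_and, Set.mem_ofPred_eq] at hj
      simp only [Finset.coe_insert, Finset.coe_singleton, Set.mem_insert_iff,
        Set.mem_singleton_iff]
      induction j using Fin.cases with
      | zero => exact absurd rfl hj
      | succ j =>
        by_contra hne
        rw [not_or] at hne
        refine hj ?_
        have ha : i ≠ j.succ := fun h => hne.1 (by rw [h])
        have hb : i ≠ j.castSucc := fun h => hne.2 (by rw [h]; simp)
        simp [g, ha, hb]
    have h2 := Finset.card_le_two (a := i.val) (b := i.val + 1)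
    have h3 := Finset.card_filter_add_card_filter_not (s := (Finset.univ : Finset (Fin (n + 1))))
      (fun j => g i j = 1)
    rw [Finset.card_univ, Fintype.card_fin] at h3
    change 2 ≤ (Finset.univ.filter fun j => g i j = 1).card
    omega
  have htotal : (n + 1) + n * (n - 1) ≤ ∑ i, hammingWt (g i) := by
    -- Double counting: weights are summed by columns, each path column having only two zeros.
    have h1 : ∑ i, hammingWt (g i) = ∑ j, (Finset.univ.filter fun i => g i j = 1).card := by
      simp only [hammingWt, Finset.card_filter]
      exact Finset.sum_comm
    rw [h1, Fin.sum_univ_succ]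
    refine add_le_add ?_ ?_
    · simp [g]
    · have h2 : ∀ j : Fin n, n - 1 ≤ (Finset.univ.filter fun i => g i j.succ = 1).card := by
        intro j
        have h3 : (Finset.univ : Finset (Fin (n + 1))) \ {j.succ, j.castSucc} ⊆
            Finset.univ.filter fun i => g i j.succ = 1 := by
          intro i hi
          simp only [Finset.mem_sdiff, Finset.mem_insert, Finset.mem_singleton, not_or] at hi
          simp [g, hi.2.1, hi.2.2]
        have h4 := Finset.card_le_card h3
        have h5 := Finset.le_card_sdiff {j.succ, j.castSucc} (Finset.univ : Finset (Fin (n + 1)))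
        have h6 := Finset.card_le_two (a := j.succ) (b := j.castSucc)
        rw [Finset.card_univ, Fintype.card_fin] at h5
        omega
      have h3 := Finset.sum_le_sum fun j (_ : j ∈ Finset.univ) => h2 j
      rw [Finset.sum_const, Finset.card_univ, Fintype.card_fin, smul_eq_mul] at h3
      exact h3
  obtain ⟨L, hL, hN⟩ := h.exists_hammingWt_le (hfree.isMinZeroSum_cons hsum) (by
    intro x hx
    rcases Multiset.mem_cons.1 hx with rfl | hx
    · rw [hammingWt_one, Fintype.card_fin]; omega
    · obtain ⟨i, _, rfl⟩ := Multiset.mem_map.1 hx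
      exact hwt2 i)
  rw [Multiset.map_cons, Multiset.sum_cons, hammingWt_one, Fintype.card_fin, Multiset.map_map] at hL
  change 2 * L = n + 1 + ∑ i, hammingWt (g i) at hL
  refine le_trans (Nat.cast_le.2 ?_) hN
  obtain ⟨k, rfl⟩ := Nat.exists_eq_add_of_le' (show 1 ≤ n by omega)
  simp only [Nat.add_sub_cancel] at htotal ⊢
  have h6 : (k + 1 + 1) * (k + 1) = (k + 1) * k + 2 * (k + 1) := by ring
  omega

end Coordinates

/-! ### Transfer from monoids with a divisor homomorphism to sequences. -/

section Model

variable {M P V : Type*} [CommMonoid M] [AddCommGroup V]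

theorem factDist_eq_multisetDist (z z' : FactMonoid M) : factDist z z' = multisetDist z z' := by
  unfold factDist multisetDist
  congr!

/-- `ψ` is a divisor homomorphism whose image consists of the sequences of class zero. -/
structure IsClassModel (ψ : M →* FreeCM P) (c : P → V) : Prop where
  dvd_of_map_dvd : ∀ a b, ψ a ∣ ψ b → a ∣ b
  exists_iff : ∀ S : Multiset P, (∃ a, ψ a = Multiplicative.ofAdd S) ↔ (S.map c).sum = 0

theorem FreeCM.eq_one_of_isUnit {x : FreeCM P} (h : IsUnit x) : x = 1 := by
  obtain ⟨y, hy⟩ := h.exists_right_inv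
  have : Multiplicative.toAdd x + Multiplicative.toAdd y = 0 := hy
  exact (add_eq_zero.1 this).1

/-- The sequence of prime divisors of an element of the reduced monoid. -/
def divisorSeq (ψ : M →* FreeCM P) : Associates M → Multiset P :=
  Quotient.lift (fun a => Multiplicative.toAdd (ψ a)) (by
    rintro a b ⟨u, rfl⟩
    have := FreeCM.eq_one_of_isUnit (u.isUnit.map ψ)
    rw [map_mul, this, mul_one])

variable {ψ : M →* FreeCM P} {c : P → V}

theorem divisorSeq_mk (a : M) : divisorSeq ψ (Associates.mk a) = Multiplicative.toAdd (ψ a) := rfl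

theorem divisorSeq_mul (x y : Associates M) :
    divisorSeq ψ (x * y) = divisorSeq ψ x + divisorSeq ψ y := by
  obtain ⟨a, rfl⟩ := Associates.mk_surjective x
  obtain ⟨b, rfl⟩ := Associates.mk_surjective y
  rw [Associates.mk_mul_mk, divisorSeq_mk, map_mul]
  rfl

theorem divisorSeq_one : divisorSeq ψ (1 : Associates M) = 0 := by
  rw [← Associates.mk_one, divisorSeq_mk, map_one]
  rfl

theorem divisorSeq_factProd (z : FactMonoid M) :
    divisorSeq ψ (factProd z) = (z.map fun u => divisorSeq ψ u.1).sum := by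
  unfold factProd
  induction z using Multiset.induction_on with
  | empty => simpa using divisorSeq_one
  | cons u z ih => simp [divisorSeq_mul, ih]

theorem tameDegreeAt_le_iff {a : M} {x : FactMonoid M} {N : ℕ∞} :
    tameDegreeAt a x ≤ N ↔ ((∃ y ∈ factSet a, x ≤ y) →
      ∀ z ∈ factSet a, ∃ z' ∈ factSet a, x ≤ z' ∧ (factDist z z' : ℕ∞) ≤ N) := by
  constructor
  · intro hN
    -- The infimum is attained, since `ℕ∞` is well-ordered and `⊤` always qualifies.
    have hmem := csInf_mem (s := {N : ℕ∞ | (∃ y ∈ factSet a, x ≤ y) →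
      ∀ z ∈ factSet a, ∃ z' ∈ factSet a, x ≤ z' ∧ (factDist z z' : ℕ∞) ≤ N})
      ⟨⊤, fun ⟨y, hy, hxy⟩ z _ => ⟨y, hy, hxy, le_top⟩⟩
    intro hex z hz
    obtain ⟨z', hz', hxz', hd⟩ := hmem hex z hz
    exact ⟨z', hz', hxz', hd.trans hN⟩
  · exact fun h => sInf_le h

namespace IsClassModel

theorem injective (h : IsClassModel ψ c) : Function.Injective (divisorSeq ψ) := by
  intro x y hxy
  obtain ⟨a, rfl⟩ := Associates.mk_surjective x
  obtain ⟨b, rfl⟩ := Associates.mk_surjective y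
  have hab : ψ a = ψ b := hxy
  obtain ⟨d, rfl⟩ := h.dvd_of_map_dvd a b (by rw [hab])
  rw [map_mul] at hab
  have hd : ψ d = 1 := by
    have : Multiplicative.toAdd (ψ a) = Multiplicative.toAdd (ψ a) + Multiplicative.toAdd (ψ d) :=
      hab
    exact left_eq_add.1 this
  have hu : IsUnit d := isUnit_iff_dvd_one.2 (h.dvd_of_map_dvd d 1 (by rw [hd, map_one]))
  rw [Associates.mk_eq_mk_iff_associated]
  exact ⟨hu.unit, rfl⟩

theorem sum_eq_zero (h : IsClassModel ψ c) (x : Associates M) :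
    ((divisorSeq ψ x).map c).sum = 0 := by
  obtain ⟨a, rfl⟩ := Associates.mk_surjective x
  exact (h.exists_iff _).1 ⟨a, rfl⟩

theorem exists_divisorSeq_eq (h : IsClassModel ψ c) {S : Multiset P} (hS : (S.map c).sum = 0) :
    ∃ x, divisorSeq ψ x = S := by
  obtain ⟨a, ha⟩ := (h.exists_iff S).2 hS
  exact ⟨Associates.mk a, by rw [divisorSeq_mk, ha]; rfl⟩

theorem divisorSeq_eq_zero_iff (h : IsClassModel ψ c) {x : Associates M} :
    divisorSeq ψ x = 0 ↔ x = 1 :=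
  ⟨fun hx => h.injective (hx.trans divisorSeq_one.symm), fun hx => hx ▸ divisorSeq_one⟩

theorem irreducible_iff (h : IsClassModel ψ c) {x : Associates M} :
    Irreducible x ↔ IsMinZeroSum ((divisorSeq ψ x).map c) := by
  constructor
  · intro hx
    refine ⟨fun h0 => ?_, h.sum_eq_zero x, fun t ht h0 hne => ?_⟩
    · have : x = 1 := h.divisorSeq_eq_zero_iff.1 (by simpa using h0)
      exact hx.not_isUnit (this ▸ isUnit_one)
    · obtain ⟨S, hS, rfl⟩ := Multiset.exists_map_eq_of_le ht
      obtain ⟨T, hT⟩ := Multiset.le_iff_exists_add.1 hS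
      have hxs := h.sum_eq_zero x
      rw [hT, Multiset.map_add, Multiset.sum_add, h0, zero_add] at hxs
      obtain ⟨y, rfl⟩ := h.exists_divisorSeq_eq h0
      obtain ⟨w, rfl⟩ := h.exists_divisorSeq_eq hxs
      rw [← divisorSeq_mul] at hT
      have hxy := h.injective hT
      rcases hx.isUnit_or_isUnit hxy with hu | hu
      · rw [Associates.isUnit_iff_eq_one] at hu
        rw [hu, divisorSeq_one] at hne
        simp at hne
      · rw [Associates.isUnit_iff_eq_one] at hu
        rw [hxy, hu, mul_one]
  · intro hx
    refine ⟨fun hu => ?_, fun {y w} hyw => ?_⟩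
    · rw [Associates.isUnit_iff_eq_one] at hu
      exact hx.ne_zero (by rw [hu, divisorSeq_one, Multiset.map_zero])
    · rw [Associates.isUnit_iff_eq_one, Associates.isUnit_iff_eq_one]
      by_contra! hne
      have hsplit : divisorSeq ψ x = divisorSeq ψ y + divisorSeq ψ w := by
        rw [hyw, divisorSeq_mul]
      have hy0 : divisorSeq ψ y ≠ 0 := fun h0 => hne.1 (h.divisorSeq_eq_zero_iff.1 h0)
      have hw0 : divisorSeq ψ w ≠ 0 := fun h0 => hne.2 (h.divisorSeq_eq_zero_iff.1 h0)
      have := hx.eq_of_le ((divisorSeq ψ y).map c)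
        (Multiset.map_le_map (hsplit ▸ Multiset.le_add_right _ _)) (h.sum_eq_zero y)
        (by simpa using hy0)
      have hc := congrArg Multiset.card this
      have hpos := Multiset.card_pos.2 hw0
      rw [hsplit] at hc
      simp only [Multiset.card_map, Multiset.card_add] at hc
      omega

/-- Every multiset of atoms over `P` comes from a factorization in `M`. -/
theorem exists_factMonoid (h : IsClassModel ψ c) {y : Multiset (Multiset P)}
    (hy : ∀ a ∈ y, IsMinZeroSum (a.map c)) :
    ∃ z : FactMonoid M, (z.map fun u => divisorSeq ψ u.1) = y := by
  induction y using Multiset.induction_on with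
  | empty => exact ⟨0, by simp⟩
  | cons a y ih =>
    obtain ⟨z, rfl⟩ := ih fun b hb => hy b (by simp [hb])
    have ha := hy a (by simp)
    obtain ⟨x, rfl⟩ := h.exists_divisorSeq_eq ha.sum_eq
    exact ⟨⟨x, h.irreducible_iff.2 ha⟩ ::ₘ z, by simp⟩

theorem mem_factSet_iff (h : IsClassModel ψ c) {a : M} {z : FactMonoid M} :
    z ∈ factSet a ↔ (z.map fun u => divisorSeq ψ u.1).sum = Multiplicative.toAdd (ψ a) := by
  rw [← divisorSeq_factProd, ← divisorSeq_mk]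
  exact h.injective.eq_iff.symm

theorem injective_atom (h : IsClassModel ψ c) :
    Function.Injective fun u : {u : Associates M // Irreducible u} => divisorSeq ψ u.1 :=
  fun _ _ huv => Subtype.ext (h.injective huv)

/-- `divisorSeq` is injective on the reduced monoid and matches its atoms with minimal zero-sum
images, so it identifies factorizations and preserves distances. -/
theorem tameDegree_le_iff (h : IsClassModel ψ c) {N : ℕ∞} : tameDegree M ≤ N ↔ TameBound c N := by
  simp only [tameDegree, localTameDegree, iSup_le_iff, tameDegreeAt_le_iff]
  constructor
  · intro hN u z hu hz huz
    obtain ⟨x, rfl⟩ := h.exists_divisorSeq_eq hu.sum_eq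
    have hx := h.irreducible_iff.2 hu
    obtain ⟨zM, rfl⟩ := h.exists_factMonoid hz
    obtain ⟨a, ha⟩ := Associates.mk_surjective (factProd zM)
    have hmem : zM ∈ factSet a := ha.symm
    have hex : ∃ y ∈ factSet a, ({⟨x, hx⟩} : FactMonoid M) ≤ y := by
      obtain ⟨T, hT⟩ := Multiset.le_iff_exists_add.1 huz
      have hs := h.sum_eq_zero (factProd zM)
      rw [divisorSeq_factProd, hT, Multiset.map_add, Multiset.sum_add, hu.sum_eq, zero_add] at hs
      obtain ⟨y, hy⟩ := exists_isFact c T hs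
      obtain ⟨yM, rfl⟩ := h.exists_factMonoid hy.atom
      refine ⟨⟨x, hx⟩ ::ₘ yM, ?_, by simp⟩
      rw [h.mem_factSet_iff] at hmem ⊢
      rw [← hmem, hT, ← hy.sum_eq]
      simp
    obtain ⟨z', hz', hxz', hd⟩ := hN ⟨x, hx⟩ a hex zM hmem
    refine ⟨z'.map fun u => divisorSeq ψ u.1, ⟨?_, ?_⟩, ?_, ?_⟩
    · rw [h.mem_factSet_iff] at hmem hz'
      rw [hz', hmem]
    · intro b hb
      obtain ⟨v, _, rfl⟩ := Multiset.mem_map.1 hb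
      exact h.irreducible_iff.1 v.2
    · exact Multiset.mem_map.2 ⟨⟨x, hx⟩, Multiset.singleton_le.1 hxz', rfl⟩
    · rw [multisetDist_map h.injective_atom, ← factDist_eq_multisetDist]
      exact hd
  · rintro hN u a ⟨y, hy, huy⟩ z hz
    obtain ⟨z', hz', huz', hd⟩ := hN (divisorSeq ψ u.1) (z.map fun u => divisorSeq ψ u.1)
      (h.irreducible_iff.1 u.2) (by
        intro b hb
        obtain ⟨v, _, rfl⟩ := Multiset.mem_map.1 hb
        exact h.irreducible_iff.1 v.2) (by
        rw [h.mem_factSet_iff] at hy hz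
        rw [hz, ← hy]
        exact Multiset.le_sum_of_mem_multiset
          (Multiset.mem_map_of_mem _ (Multiset.singleton_le.1 huy)))
    obtain ⟨zM, rfl⟩ := h.exists_factMonoid hz'.atom
    refine ⟨zM, ?_, ?_, ?_⟩
    · rw [h.mem_factSet_iff] at hz ⊢
      rw [← hz, hz'.sum_eq]
    · obtain ⟨v, hv, hvu⟩ := Multiset.mem_map.1 huz'
      rw [← h.injective_atom hvu]
      exact Multiset.singleton_le.2 hv
    · rw [multisetDist_map h.injective_atom, ← factDist_eq_multisetDist] at hd
      exact hd

end IsClassModel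

end Model

/-! ### The class group, and the two monoids as class models. -/

section ClassGroup

theorem GrothendieckGroup.of_injective {P : Type*} :
    Function.Injective (Algebra.GrothendieckGroup.of : FreeCM P →* _) := by
  intro x y hxy
  obtain ⟨d, hd⟩ := (Localization.monoidOf (⊤ : Submonoid (FreeCM P))).eq_iff_exists.1 hxy
  have : Multiplicative.toAdd (d : FreeCM P) + Multiplicative.toAdd x =
    Multiplicative.toAdd (d : FreeCM P) + Multiplicative.toAdd y := hd
  have h2 : Multiplicative.toAdd x = Multiplicative.toAdd y := add_left_cancel this
  exact h2

variable {H P : Type*} [CommMonoid H] {φ : H →* FreeCM P}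

theorem exists_mul_of_mem_closure {x : Algebra.GrothendieckGroup (FreeCM P)}
    (hx : x ∈ Subgroup.closure (Set.range fun a : H => Algebra.GrothendieckGroup.of (φ a))) :
    ∃ a b : H, x * Algebra.GrothendieckGroup.of (φ b) = Algebra.GrothendieckGroup.of (φ a) := by
  induction hx using Subgroup.closure_induction with
  | mem x hx =>
    obtain ⟨a, rfl⟩ := hx
    exact ⟨a, 1, by simp⟩
  | one => exact ⟨1, 1, by simp⟩
  | mul x y _ _ hx hy =>
    obtain ⟨a, b, h1⟩ := hx
    obtain ⟨a', b', h2⟩ := hy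
    exact ⟨a * a', b * b', by rw [map_mul, map_mul, map_mul, map_mul, ← h1, ← h2, mul_mul_mul_comm]⟩
  | inv x _ hx =>
    obtain ⟨a, b, h1⟩ := hx
    exact ⟨b, a, by rw [← h1, inv_mul_cancel_left]⟩

/-- A trivial class gives `S · φ(b) = φ(a)`; the divisor property then yields `b ∣ a`, and the
quotient maps to `S` by cancellation. -/
theorem mk_of_eq_one_iff (hφ : IsDivisorTheory φ) (S : FreeCM P) :
    (QuotientGroup.mk (Algebra.GrothendieckGroup.of S) : DivClassGroup φ) = 1 ↔
      ∃ a, φ a = S := by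
  rw [QuotientGroup.eq_one_iff]
  constructor
  · intro h
    obtain ⟨a, b, hab⟩ := exists_mul_of_mem_closure h
    rw [← map_mul] at hab
    have hab' := GrothendieckGroup.of_injective hab
    obtain ⟨d, rfl⟩ := hφ.dvd_of_map_dvd b a (Dvd.intro_left S hab')
    refine ⟨d, ?_⟩
    rw [map_mul, mul_comm] at hab'
    have : Multiplicative.toAdd (φ b) + Multiplicative.toAdd S =
      Multiplicative.toAdd (φ b) + Multiplicative.toAdd (φ d) := hab'
    exact (add_left_cancel this).symm
  · rintro ⟨a, rfl⟩
    exact Subgroup.subset_closure ⟨a, rfl⟩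

variable {V : Type*} [AddCommGroup V]

theorem sum_map_primeClass (e : Additive (DivClassGroup φ) ≃+ V) (S : Multiset P) :
    (S.map fun p => e (Additive.ofMul (primeClass φ p))).sum =
      e (Additive.ofMul (QuotientGroup.mk
        (Algebra.GrothendieckGroup.of (Multiplicative.ofAdd S)))) := by
  induction S using Multiset.induction_on with
  | empty =>
    rw [Multiset.map_zero, Multiset.sum_zero, ofAdd_zero, map_one, QuotientGroup.mk_one, ofMul_one,
      map_zero]
  | cons p S ih =>
    rw [Multiset.map_cons, Multiset.sum_cons, ih, ← map_add, ← ofMul_mul, primeClass,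
      ← QuotientGroup.mk_mul, ← map_mul]
    rfl

theorem isClassModel_of_isDivisorTheory (hφ : IsDivisorTheory φ)
    (e : Additive (DivClassGroup φ) ≃+ V) :
    IsClassModel φ fun p => e (Additive.ofMul (primeClass φ p)) := by
  refine ⟨hφ.dvd_of_map_dvd, fun S => ?_⟩
  rw [sum_map_primeClass, ← mk_of_eq_one_iff hφ, EmbeddingLike.map_eq_zero_iff]
  exact Iff.rfl

theorem isClassModel_zeroSumMonoid {G : Type*} [AddCommGroup G] (e : G ≃+ V) :
    IsClassModel (zeroSumMonoid G).subtype e := by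
  refine ⟨fun a b hab => ?_, fun S => ?_⟩
  · obtain ⟨R, hR⟩ := hab
    have ha : (Multiplicative.toAdd (a : FreeCM G)).sum = 0 := a.2
    have hb : (Multiplicative.toAdd (b : FreeCM G)).sum = 0 := b.2
    have hR' : Multiplicative.toAdd (b : FreeCM G) =
      Multiplicative.toAdd (a : FreeCM G) + Multiplicative.toAdd R := hR
    rw [hR', Multiset.sum_add, ha, zero_add] at hb
    exact ⟨⟨R, hb⟩, Subtype.ext hR⟩
  · rw [← map_multiset_sum, EmbeddingLike.map_eq_zero_iff]
    constructor
    · rintro ⟨a, ha⟩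
      have h2 : (Multiplicative.toAdd (a : FreeCM G)).sum = 0 := a.2
      have h3 : Multiplicative.toAdd (a : FreeCM G) = S := congrArg Multiplicative.toAdd ha
      rwa [h3] at h2
    · exact fun h => ⟨⟨Multiplicative.ofAdd S, h⟩, rfl⟩

theorem zeroSumTameDegree_le_iff {G : Type*} [AddCommGroup G] (e : G ≃+ V) {N : ℕ∞} :
    zeroSumTameDegree G ≤ N ↔ TameBound (id : V → V) N := by
  rw [zeroSumTameDegree, (isClassModel_zeroSumMonoid e).tameDegree_le_iff]
  constructor
  · intro h
    have := h.comp_injective e.symm.injective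
    have he : (e : G → V) ∘ e.symm = id := funext fun x => e.apply_symm_apply x
    rwa [he] at this
  · intro h
    exact TameBound.comp_injective (c := (id : V → V)) (f := e) e.injective h

/-- Choosing one prime in each class embeds the sequences over `V`; this gives `t(G) ≤ t(H)`. -/
theorem TameBound.id_of_surjective {Q : Type*} {c : Q → V} (hc : Function.Surjective c) {N : ℕ∞}
    (h : TameBound c N) : TameBound (id : V → V) N := by
  have := h.comp_injective (Function.injective_surjInv hc)
  have he : c ∘ Function.surjInv hc = id := funext fun x => Function.surjInv_eq hc x
  rwa [he] at this

/-- A class group of order two has two prime divisors in its nontrivial class. -/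
theorem IsDivisorTheory.exists_two_primes [Module (ZMod 2) V] [FiniteDimensional (ZMod 2) V]
    (hφ : IsDivisorTheory φ) {c : P → V} (hM : IsClassModel φ c)
    (hr : Module.finrank (ZMod 2) V = 1) (hc : Function.Surjective c) :
    ∃ p q, p ≠ q ∧ c p = c q ∧ c p ≠ 0 := by
  have : Nontrivial V := Module.nontrivial_of_finrank_pos (R := ZMod 2) (by omega)
  obtain ⟨g, hg⟩ := exists_ne (0 : V)
  obtain ⟨p, rfl⟩ := hc g
  by_contra! hno
  have huniq : ∀ q, c q ≠ 0 → q = p := by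
    intro q hq
    by_contra hne
    refine hg (hno p q (Ne.symm hne) ?_)
    obtain ⟨a, ha⟩ := finrank_eq_one_iff_of_nonzero' (c p) hg |>.1 hr (c q)
    have h01 : ∀ a : ZMod 2, a = 0 ∨ a = 1 := by decide
    rcases h01 a with rfl | rfl
    · rw [zero_smul] at ha
      exact absurd ha.symm hq
    · rwa [one_smul] at ha
  obtain ⟨X, _, hX⟩ := hφ.exists_gcd p
  have hpX := (hX (FreeCM.of p)).1 dvd_rfl
  -- If `p` were the only prime outside the trivial class, it would occur evenly in every principal
  -- divisor, so `p²` would divide any gcd that `p` divides.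
  have h2 : (Multiplicative.ofAdd ({p, p} : Multiset P) : FreeCM P) ∣ FreeCM.of p := by
    refine (hX _).2 fun x hx => ?_
    obtain ⟨R, hR⟩ := hpX x hx
    have hR' : Multiplicative.toAdd (φ x) = {p} + Multiplicative.toAdd R := hR
    have hle := pair_le_of_sum_eq_zero hg huniq (S := Multiplicative.toAdd (φ x))
      ((hM.exists_iff _).1 ⟨x, rfl⟩) (by rw [hR']; simp)
    obtain ⟨T, hT⟩ := Multiset.le_iff_exists_add.1 hle
    exact ⟨Multiplicative.ofAdd T, hT⟩
  obtain ⟨R, hR⟩ := h2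
  have hR' : ({p} : Multiset P) = {p, p} + Multiplicative.toAdd R := hR
  have := congrArg Multiset.card hR'
  simp only [Multiset.card_singleton, Multiset.card_add, Multiset.card_pair] at this
  omega

end ClassGroup

end

/-! ### Assembly of the bounds. -/

theorem theorem5p1 {H P : Type*} [CancelCommMonoid H]
    (φ : H →* FreeCM P) (hφ : IsDivisorTheory φ)
    (r : ℕ) (hr : 1 ≤ r)
    (hG : Nonempty (Additive (DivClassGroup φ) ≃+ (Fin r → ZMod 2)))
    (hP : ∀ g : DivClassGroup φ, ∃ p : P, primeClass φ p = g) :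
    (r = 1 → tameDegree H = 2 ∧ zeroSumTameDegree (Additive (DivClassGroup φ)) = 0) ∧
    (r = 3 → zeroSumTameDegree (Additive (DivClassGroup φ)) = 4 ∧
      ((∃ g : DivClassGroup φ, g ≠ 1 ∧
          ∃ p q : P, p ≠ q ∧ primeClass φ p = g ∧ primeClass φ q = g) →
        tameDegree H = 5)) ∧
    (2 ≤ r → Even r →
      tameDegree H = zeroSumTameDegree (Additive (DivClassGroup φ)) ∧
      zeroSumTameDegree (Additive (DivClassGroup φ)) = ((1 + r ^ 2 / 2 : ℕ) : ℕ∞)) ∧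
    (5 ≤ r → Odd r →
      tameDegree H = zeroSumTameDegree (Additive (DivClassGroup φ)) ∧
      ((2 + r * (r - 1) / 2 : ℕ) : ℕ∞) ≤
        zeroSumTameDegree (Additive (DivClassGroup φ))) := by
  obtain ⟨e⟩ := hG
  have hM := isClassModel_of_isDivisorTheory hφ e
  set c : P → Fin r → ZMod 2 := fun p => e (Additive.ofMul (primeClass φ p)) with hc
  have hfin : Module.finrank (ZMod 2) (Fin r → ZMod 2) = r := by simp
  have hsurj : Function.Surjective c := by
    intro v
    obtain ⟨p, hp⟩ := hP (Additive.toMul (e.symm v))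
    exact ⟨p, by simp [hc, hp]⟩
  have hH : TameBound c (tameDegree H) := hM.tameDegree_le_iff.1 le_rfl
  have hB : TameBound (id : (Fin r → ZMod 2) → _)
      (zeroSumTameDegree (Additive (DivClassGroup φ))) := (zeroSumTameDegree_le_iff e).1 le_rfl
  have hGH : zeroSumTameDegree (Additive (DivClassGroup φ)) ≤ tameDegree H :=
    (zeroSumTameDegree_le_iff e).2 (hH.id_of_surjective hsurj)
  refine ⟨?_, ?_, ?_, ?_⟩
  · rintro rfl
    refine ⟨le_antisymm (hM.tameDegree_le_iff.2 (tameBound_of_rank_one hfin)) ?_,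
      le_antisymm ((zeroSumTameDegree_le_iff e).2 (tameBound_id_of_rank_one hfin)) bot_le⟩
    obtain ⟨p, q, hpq, hcpq, h0⟩ := hφ.exists_two_primes hM hfin hsurj
    exact hH.two_le_of_ne hpq hcpq h0
  · rintro rfl
    refine ⟨le_antisymm ((zeroSumTameDegree_le_iff e).2 (tameBound_id_of_rank_three hfin))
      (hB.card_add_one_le (by simp)), ?_⟩
    rintro ⟨g, hg, p, q, hpq, hp, hq⟩
    refine le_antisymm ?_ ?_
    · have := hM.tameDegree_le_iff.2
        (tameBound_of_odd hfin le_rfl (by decide) (tameBound_id_of_rank_three hfin))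
      refine this.trans (max_le ?_ ?_) <;> norm_num
    · refine hH.five_le hfin hsurj hpq (g := e (Additive.ofMul g)) (by simp [hc, hp])
        (by simp [hc, hq]) ?_
      rw [Ne, EmbeddingLike.map_eq_zero_iff]
      exact hg
  · intro h2 heven
    have hle := hM.tameDegree_le_iff.2 (tameBound_of_even hfin h2 heven)
    have hge : ((1 + r ^ 2 / 2 : ℕ) : ℕ∞) ≤
        zeroSumTameDegree (Additive (DivClassGroup φ)) := by
      by_cases h4 : 4 ≤ r
      · exact hB.le_of_even h4 heven
      -- For `r = 2` the value is `3 = r + 1`, reached by the squares of a minimal zero-sum sequence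
      -- of length 3.
      · have hr2 : r = 2 := by
          obtain ⟨k, hk⟩ := heven
          omega
        subst hr2
        exact hB.card_add_one_le (by simp)
    exact ⟨le_antisymm (hle.trans hge) hGH, le_antisymm (hGH.trans hle) hge⟩
  · intro h5 hodd
    have hge := hB.le_of_odd h5 hodd
    -- Applied with `t = t(G)`; the lower bound `hge` then makes the maximum equal to `t(G)`.
    have hle := hM.tameDegree_le_iff.2 (tameBound_of_odd hfin (by omega) hodd hB)
    exact ⟨le_antisymm (hle.trans (max_le le_rfl hge)) hGH, hge⟩
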